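/- Let $\mathcal{C}$ be a small non-empty category, $\mathcal{D}$ a locally small category, $\iota:\mathcal{C}\hookrightarrow\mathcal{D}$ a full and faithful functor (we write $c$ for $\iota(c)$), and $u$ an object of $\mathcal{D}$ that is - *$\mathcal{C}$-universal*: every object $c$ of $\mathcal{C}$ admits an arrow $c\to u$ in $\mathcal{D}$; - *$\mathcal{C}$-ultrahomogeneous*: for all arrows $j:a\to b$ in $\mathcal{C}$ and $\chi_1:a\to u$, $\chi_2:b\to u$ in $\mathcal{D}$ there is an automorphism $\check{\jmath}$ of $u$ with $\check{\jmath}\circ\chi_1=\chi_2\circ j$. Suppose moreover that (a) for all objects $a,b$ of $\mathcal{C}$ and arrows $\xi:a\to u$, $\chi:b\to u$ in $\mathcal{D}$ there are arrows $f:a\to c$, $g:b\to c$ in $\mathcal{C}$ and an arrow $\epsilon:c\to u$ in $\mathcal{D}$ with $\epsilon\circ f=\xi$ and $\epsilon\circ g=\chi$; (b) for all arrows $f,g:a\to b$ in $\mathcal{C}$ and every arrow $\chi:b\to u$ in $\mathcal{D}$, $\chi\circ f=\chi\circ g$ implies $f=g$. Conventions. A family of subgroups of a topological group $G$ is an *algebraic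 base* of $G$ if it is a neighbourhood basis of the identity, any intersection of two members contains a member, and it is closed under conjugation. For a full and faithful functor $\mathcal{C}\hookrightarrow\mathcal{E}$ and an object $v$ of $\mathcal{E}$, the group of automorphisms of $v$ carries the topology generated by the left cosets of the subgroups $\mathcal{I}_\chi=\{f:v\cong v\mid f\circ\chi=\chi\}$, for arrows $\chi:c\to v$ with $c$ in $\mathcal{C}$. It is written $\mathrm{Aut}_{\mathcal{D}}(u)$ for $(\mathcal{E},v)=(\mathcal{D},u)$, and $\mathrm{Aut}_{\mathcal{C}}(v)$ when $\mathcal{E}$ is the ind-completion $\mathrm{Ind}\text{-}\mathcal{C}$. For a topological group $G$, $\mathbf{Cont}(G)$ is the topos of continuous left actions of $G$ on discrete sets; $p_G$ is its canonical point, whose inverse image is the forgetful functor to sets; $\mathrm{Aut}(p_G)$ is the group of automorphisms of $p_G$, with the topology generated by the left cosets of the subgroups $\{\alpha\mid\alpha_X(x)=x\}$, for $X$ in $\mathbf{Cont}(G)$ and $x\in X$; and $\xi_G:G\to\mathrm{Aut}(p_G)$ sends $g$ to the action of $g$. A continuous homomorphism $\theta:G\to H$ *exhibits $H$ as the completion of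 $G$* if there is an isomorphism of topological groups $\kappa:H\cong\mathrm{Aut}(p_G)$ with $\kappa\circ\theta=\xi_G$. Then: 1. $\mathcal{C}$ satisfies the amalgamation property (every pair of arrows with common domain can be completed to a commutative square; hence the atomic topology $J_{at}$ on $\mathcal{C}^{\mathrm{op}}$, whose covering sieves are the non-empty ones, is defined) and the joint embedding property (any two objects of $\mathcal{C}$ admit arrows to a common object), and the subgroups $\mathcal{I}_\chi$ form an algebraic base of the topological group $\mathrm{Aut}_{\mathcal{D}}(u)$. 2. The category $\mathcal{C}/u$ of pairs $(c,\xi:c\to u)$ is filtered, and the canonical functor $\mathcal{C}/u\to\mathcal{C}\to\mathrm{Ind}\text{-}\mathcal{C}$ has a colimit $\tilde u$, with colimit arrows $J_{(c,\xi)}:c\to\tilde u$. The object $\tilde u$ is $\mathcal{C}$-universal and $\mathcal{C}$-ultrahomogeneous (with respect to $\mathcal{C}\hookrightarrow\mathrm{Ind}\text{-}\mathcal{C}$), and the subgroups $\mathcal{I}_\chi$ form an algebraic base of the topological group $\mathrm{Aut}_{\mathcal{C}}(\tilde u)$. 3. There is a continuous homomorphism $\theta:\mathrm{Aut}_{\mathcal{D}}(u)\to\mathrm{Aut}_{\mathcal{C}}(\tilde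 u)$ with $\theta(j)\circ J_{(c,\xi)}=J_{(c,\,j\circ\xi)}$ for all $j$ and $(c,\xi)$, and it exhibits $\mathrm{Aut}_{\mathcal{C}}(\tilde u)$ as the completion of $\mathrm{Aut}_{\mathcal{D}}(u)$. 4. There are equivalences of toposes $$\mathbf{Sh}(\mathcal{C}^{\mathrm{op}},J_{at})\simeq\mathbf{Cont}(\mathrm{Aut}_{\mathcal{D}}(u))\simeq\mathbf{Cont}(\mathrm{Aut}_{\mathcal{C}}(\tilde u)).$$ The first one, and the composite of the two, send the sheaf associated with the representable $\mathrm{Hom}_{\mathcal{C}}(c,-)$, naturally in $c$, to the set $\mathrm{Hom}_{\mathcal{D}}(c,u)$, respectively $\mathrm{Hom}_{\mathrm{Ind}\text{-}\mathcal{C}}(c,\tilde u)$, with the action of the automorphism group by composition; the inverse of the second one is the restriction of actions along $\theta$. -/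

import Mathlib

open CategoryTheory Limits Topology Opposite

universe w v u

namespace GaloisRep

/-! ### Amalgamation, joint embedding and the atomic topology -/

/-- The amalgamation property: every span can be completed to a commutative square. -/
def AmalgamationProperty (C : Type u) [Category.{v} C] : Prop :=
  ∀ ⦃a b c : C⦄ (f : a ⟶ b) (g : a ⟶ c),
    ∃ (d : C) (f' : b ⟶ d) (g' : c ⟶ d), f ≫ f' = g ≫ g'

/-- The joint embedding property: any two objects map to a common object. -/
def JointEmbeddingProperty (C : Type u) [Category.{v} C] : Prop :=
  ∀ a b : C, ∃ c : C, Nonempty (a ⟶ c) ∧ Nonempty (b ⟶ c)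

theorem AmalgamationProperty.rightOre {C : Type u} [Category.{v} C]
    (h : AmalgamationProperty C) : GrothendieckTopology.RightOreCondition Cᵒᵖ := by
  intro X Y Z f g
  obtain ⟨d, f', g', e⟩ := h f.unop g.unop
  exact ⟨op d, f'.op, g'.op, Quiver.Hom.unop_inj e⟩

/-- The atomic topology on `Cᵒᵖ` (the covering sieves are the non-empty ones), for a category `C`
with the amalgamation property. -/
def atomicTopology {C : Type u} [Category.{v} C] (h : AmalgamationProperty C) :
    GrothendieckTopology Cᵒᵖ :=
  GrothendieckTopology.atomic h.rightOre

/-! ### Universal and ultrahomogeneous objects -/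

section Homogeneity

variable {C : Type u} [Category.{v} C] {D : Type*} [Category* D] (ι : C ⥤ D) (U : D)

/-- `U` is `C`-universal: every object of `C` has an arrow to `U`. -/
def IsUniversal : Prop := ∀ c : C, Nonempty (ι.obj c ⟶ U)

/-- `U` is `C`-ultrahomogeneous. -/
def IsUltrahomogeneous : Prop :=
  ∀ ⦃a b : C⦄ (j : a ⟶ b) (χ₁ : ι.obj a ⟶ U) (χ₂ : ι.obj b ⟶ U),
    ∃ φ : U ≅ U, χ₁ ≫ φ.hom = ι.map j ≫ χ₂

end Homogeneity

/-! ### Topologies on groups generated by families of subgroups -/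

/-- The topology on a group generated by the left cosets of the members of a family of subgroups. -/
@[reducible]
def cosetTopology {G : Type*} [Group G] (B : Set (Subgroup G)) : TopologicalSpace G :=
  TopologicalSpace.generateFrom {S | ∃ N ∈ B, ∃ g : G, S = {h | g⁻¹ * h ∈ N}}

/-- The family `B` of subgroups is an algebraic base of the topological group `G`. -/
structure IsAlgebraicBase {G : Type*} [Group G] [TopologicalSpace G] (B : Set (Subgroup G)) :
    Prop where
  isTopologicalGroup : IsTopologicalGroup G
  hasBasis : (𝓝 (1 : G)).HasBasis (fun N : Subgroup G => N ∈ B) (fun N => (N : Set G))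
  inter : ∀ N ∈ B, ∀ M ∈ B, ∃ P ∈ B, P ≤ N ⊓ M
  conj : ∀ N ∈ B, ∀ g : G, N.map (MulAut.conj g).toMonoidHom ∈ B

/-! ### The topos of continuous actions of a topological group -/

section Cont

variable (G : Type w) [Group G] [TopologicalSpace G]

/-- A `G`-set `X` is continuous if its action `G × X → X` is continuous, where `X` is discrete. -/
def IsContinuousAction : ObjectProperty (Action (Type w) G) := fun X =>
  letI : TopologicalSpace X.V := ⊥
  Continuous fun p : G × X.V => X.ρ p.1 p.2

variable {G} in
theorem isContinuousAction_of_isOpen (X : Action (Type w) G)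
    (h : ∀ x y : X.V, IsOpen {g : G | X.ρ g x = y}) : IsContinuousAction G X := by
  let : TopologicalSpace X.V := ⊥
  have : DiscreteTopology X.V := ⟨rfl⟩
  change Continuous fun p : G × X.V => X.ρ p.1 p.2
  rw [continuous_discrete_rng]
  intro y
  rw [isOpen_prod_iff]
  intro g x hgx
  refine ⟨{g | X.ρ g x = y}, {x}, h x y, isOpen_discrete _, hgx, rfl, ?_⟩
  rintro ⟨g', x'⟩ ⟨h1, h2⟩
  obtain rfl : x' = x := h2
  exact h1

/-- The category of continuous left `G`-sets and equivariant maps. -/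
abbrev Cont : Type (w + 1) := (IsContinuousAction G).FullSubcategory

/-- The forgetful functor from continuous `G`-sets to sets; it is the inverse image functor of the
canonical point of `Cont G`. -/
def Cont.forget : Cont G ⥤ Type w :=
  (IsContinuousAction G).ι ⋙ Action.forget (Type w) G

variable {G} in
/-- The functor `Cont H ⥤ Cont G` that restricts actions along a continuous homomorphism. -/
def Cont.res {H : Type w} [Group H] [TopologicalSpace H] (θ : G →ₜ* H) : Cont H ⥤ Cont G :=
  ObjectProperty.lift _ ((IsContinuousAction H).ι ⋙ Action.res (Type w) θ.toMonoidHom) fun X => by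
    let : TopologicalSpace X.obj.V := ⊥
    have hX : Continuous fun p : H × X.obj.V => X.obj.ρ p.1 p.2 := X.property
    have hθ : Continuous fun p : G × X.obj.V => (θ p.1, p.2) := by fun_prop
    exact hX.comp hθ

/-! ### The completion of a topological group -/

/-- The group of automorphisms of the canonical point of `Cont G`. -/
def PointAut : Type (w + 1) := Aut (Cont.forget G)

instance : Group (PointAut G) := inferInstanceAs (Group (Aut (Cont.forget G)))

variable {G} in
/-- The bijection of `X` underlying an automorphism of the canonical point, for a continuous
`G`-set `X`. -/
def PointAut.act (α : PointAut G) (X : Cont G) (x : X.obj.V) : X.obj.V :=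
  (Iso.hom (C := Cont G ⥤ Type w) α).app X x

variable {G} in
/-- The automorphisms of the canonical point that fix an element `x` of a continuous `G`-set. -/
def PointAut.stabilizer (X : Cont G) (x : X.obj.V) : Subgroup (PointAut G) where
  carrier := {α | α.act X x = x}
  one_mem' := rfl
  mul_mem' {α β} hα hβ := by
    change α.act X (β.act X x) = x
    rw [Set.mem_ofPred_eq] at hα hβ
    rw [hβ, hα]
  inv_mem' {α} hα := by
    have h : (α⁻¹ * α).act X x = x := by rw [inv_mul_cancel]; rfl
    change (α⁻¹).act X (α.act X x) = x at h
    rw [Set.mem_ofPred_eq] at hα ⊢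
    rwa [hα] at h

instance : TopologicalSpace (PointAut G) :=
  cosetTopology {N | ∃ (X : Cont G) (x : X.obj.V), N = PointAut.stabilizer X x}

/-- The canonical homomorphism from `G` to the automorphism group of the canonical point of `Cont G`:
it sends `g` to the action of `g` on all continuous `G`-sets. -/
def toPointAut : G →* PointAut G where
  toFun g := NatIso.ofComponents (F := Cont.forget G) (G := Cont.forget G)
    (fun X =>
      { hom := X.obj.ρ g
        inv := X.obj.ρ g⁻¹
        hom_inv_id := by
          change X.obj.ρ g⁻¹ * X.obj.ρ g = 1
          rw [← map_mul, inv_mul_cancel, map_one]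
        inv_hom_id := by
          change X.obj.ρ g * X.obj.ρ g⁻¹ = 1
          rw [← map_mul, mul_inv_cancel, map_one] })
    (fun f => (f.hom.comm g).symm)
  map_one' := by
    apply Iso.ext
    ext X : 2
    exact X.obj.ρ.map_one
  map_mul' g h := by
    apply Iso.ext
    ext X : 2
    exact X.obj.ρ.map_mul g h

theorem toPointAut_act (g : G) (X : Cont G) (x : X.obj.V) :
    (toPointAut G g).act X x = X.obj.ρ g x := rfl

variable {G} in
/-- `θ : G → H` exhibits the topological group `H` as the completion of `G`: it is identified, by an
isomorphism of topological groups, with the canonical map from `G` to the automorphism group of the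
canonical point of `Cont G`. -/
def IsCompletion {H : Type w} [Group H] [TopologicalSpace H] (θ : G →* H) : Prop :=
  ∃ κ : H ≃ₜ* PointAut G, ∀ g : G, κ (θ g) = toPointAut G g

end Cont

/-! ### The topological automorphism group of an object -/

section AutGroup

variable {C : Type w} [SmallCategory C] {D : Type u} [Category.{w} D] (ι : C ⥤ D) (U : D)

/-- The group of automorphisms of `U` in `D`, with the topology of pointwise convergence on the
arrows from objects of `C` to `U`. The product `g * h` is `g ∘ h`. -/
def AutGroup (_ι : C ⥤ D) (U : D) : Type w := Aut U

instance : Group (AutGroup ι U) := inferInstanceAs (Group (Aut U))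

variable {ι U}

/-- The arrow underlying an automorphism. -/
def AutGroup.hom (g : AutGroup ι U) : U ⟶ U := Iso.hom (X := U) (Y := U) g

theorem AutGroup.mul_hom (g h : AutGroup ι U) : (g * h).hom = h.hom ≫ g.hom := rfl

theorem AutGroup.one_hom : (1 : AutGroup ι U).hom = 𝟙 U := rfl

/-- The subgroup of the automorphisms `f` of `U` such that `f ∘ χ = χ`. -/
def AutGroup.stabilizer {c : C} (χ : ι.obj c ⟶ U) : Subgroup (AutGroup ι U) where
  carrier := {f | χ ≫ f.hom = χ}
  one_mem' := Category.comp_id χ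
  mul_mem' {f g} hf hg := by
    rw [Set.mem_ofPred_eq] at hf hg ⊢
    rw [AutGroup.mul_hom, ← Category.assoc, hg, hf]
  inv_mem' {f} hf := by
    rw [Set.mem_ofPred_eq] at hf ⊢
    have h : χ ≫ (f⁻¹ * f).hom = χ := by rw [inv_mul_cancel, AutGroup.one_hom, Category.comp_id]
    rwa [AutGroup.mul_hom, ← Category.assoc, hf] at h

variable (ι U) in
/-- The family of the stabilizers of all arrows from objects of `C` to `U`. -/
def stabilizers : Set (Subgroup (AutGroup ι U)) :=
  {N | ∃ (c : C) (χ : ι.obj c ⟶ U), N = AutGroup.stabilizer χ}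

instance : TopologicalSpace (AutGroup ι U) := cosetTopology (stabilizers ι U)

theorem AutGroup.isOpen_setOf_comp_eq {c : C} (χ χ' : ι.obj c ⟶ U) :
    IsOpen {g : AutGroup ι U | χ ≫ g.hom = χ'} := by
  by_cases h : ∃ g : AutGroup ι U, χ ≫ g.hom = χ'
  · obtain ⟨g, rfl⟩ := h
    refine TopologicalSpace.isOpen_generateFrom_of_mem
      ⟨AutGroup.stabilizer χ, ⟨c, χ, rfl⟩, g, ?_⟩
    ext k
    change χ ≫ k.hom = χ ≫ g.hom ↔ χ ≫ (g⁻¹ * k).hom = χ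
    have e₁ : g⁻¹.hom ≫ g.hom = 𝟙 U := congrArg AutGroup.hom (mul_inv_cancel g)
    have e₂ : g.hom ≫ g⁻¹.hom = 𝟙 U := congrArg AutGroup.hom (inv_mul_cancel g)
    rw [AutGroup.mul_hom]
    constructor
    · intro hk
      rw [← Category.assoc, hk, Category.assoc, e₂, Category.comp_id]
    · intro hk
      conv_rhs => rw [← hk]
      rw [Category.assoc, Category.assoc, e₁, Category.comp_id]
  · convert isOpen_empty
    ext g
    exact iff_of_false (fun hg => h ⟨g, hg⟩) (fun hg => hg)

variable (ι U) in
/-- The set of arrows from `c` to `U`, with the action of the automorphisms of `U` by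
composition. -/
def homAction (c : C) : Action (Type w) (AutGroup ι U) where
  V := ι.obj c ⟶ U
  ρ :=
    { toFun g := ↾fun χ => χ ≫ g.hom
      map_one' := ConcreteCategory.hom_ext (C := Type w) _ _ fun χ => Category.comp_id χ
      map_mul' g h := ConcreteCategory.hom_ext (C := Type w) _ _ fun χ =>
        (Category.assoc χ h.hom g.hom).symm }

variable (ι U) in
/-- The functor `Cᵒᵖ ⥤ Cont (Aut U)` that sends `c` to the set of arrows from `c` to `U`, and `f` to
the precomposition with `f`. -/
def homFunctor : Cᵒᵖ ⥤ Cont (AutGroup ι U) where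
  obj c := ⟨homAction ι U c.unop,
    isContinuousAction_of_isOpen _ fun χ χ' => AutGroup.isOpen_setOf_comp_eq χ χ'⟩
  map f := ObjectProperty.homMk
    { hom := ↾fun χ => ι.map f.unop ≫ χ
      comm g := by
        ext χ
        exact (Category.assoc (ι.map f.unop) χ g.hom).symm }
  map_id c := by
    apply ObjectProperty.hom_ext
    apply Action.Hom.ext
    ext χ
    have h : ∀ χ : ι.obj c.unop ⟶ U, ι.map (𝟙 c.unop) ≫ χ = χ := fun χ => by
      rw [ι.map_id, Category.id_comp]
    exact h χ
  map_comp f g := by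
    apply ObjectProperty.hom_ext
    apply Action.Hom.ext
    ext χ
    have h : ∀ χ : ι.obj _ ⟶ U,
        ι.map (g.unop ≫ f.unop) ≫ χ = ι.map g.unop ≫ ι.map f.unop ≫ χ := fun χ => by
      rw [ι.map_comp, Category.assoc]
    exact h χ

end AutGroup

/-- The composite of the Yoneda embedding of `Cᵒᵖ` with the associated sheaf functor for the atomic
topology. -/
noncomputable def sheafifiedYoneda {C : Type w} [SmallCategory C] (h : AmalgamationProperty C) :
    Cᵒᵖ ⥤ Sheaf (atomicTopology h) (Type w) :=
  yoneda ⋙ presheafToSheaf (atomicTopology h) (Type w)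

end GaloisRep

open GaloisRep

/-! Write G for the automorphism group of `U`. Ultrahomogeneity, applied to identities, makes G
transitive on the arrows from each c to `U`. Condition (b) says that two parallel arrows of C with
the same composite to `U` are equal, and (a) says that arrows to `U` are directed; so C/U is a
directed preorder. These conditions are bundled in `IsHomogeneous`.

Objects of C are compact in Ind-C, so the arrows from c to the colimit are exactly the colimit
arrows indexed by arrows from c to `U` (`bijective_indArrow`). Hence the ind-object is homogeneous
too (`ind`), and its automorphisms are those of the presheaf of arrows to `U`. A basic neighbourhood
of an automorphism fixes its effect on one arrow, so the comparison homomorphism is inducing, and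
dense by transitivity.

Along a dense inducing homomorphism θ from G to H, every continuous action on a discrete set extends
uniquely: elements of G close to h in H all move a given point in the same way. Therefore
restriction along θ is an equivalence (`res_isEquivalence`), and H acts on the canonical point of
`Cont G`. Every element of a continuous G-set lies in the image of some set of arrows from c to `U`,
so an automorphism of the point is determined by an automorphism of the presheaf of arrows, that is,
by an automorphism of the ind-object (`bijective_extendToPointAut`).

For sheaves, the nerve sends X to the presheaf of equivariant maps into X from the sets of arrows to
`U`. In the other direction a sheaf F gives the G-set of its germs, the colimit of F over C/U. A
section of the nerve is determined by one value, and a section of a sheaf by one germ; this makes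
the nerve an equivalence onto atomic sheaves (`nerveSheaf_isEquivalence`). A representable is
locally isomorphic to the nerve of its set of arrows (`w_yonedaToNerve`). -/

namespace GaloisRep

/-! ### Actions, elementwise -/

section ContBasic

variable {G : Type w} [Group G] [TopologicalSpace G]

theorem Cont.one_act (X : Cont G) (x : X.obj.V) : X.obj.ρ 1 x = x :=
  ConcreteCategory.congr_hom X.obj.ρ.map_one x

theorem Cont.mul_act (X : Cont G) (g h : G) (x : X.obj.V) :
    X.obj.ρ (g * h) x = X.obj.ρ g (X.obj.ρ h x) :=
  ConcreteCategory.congr_hom (X.obj.ρ.map_mul g h) x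

theorem Cont.hom_act {X Y : Cont G} (f : X ⟶ Y) (g : G) (x : X.obj.V) :
    f.hom.hom (X.obj.ρ g x) = Y.obj.ρ g (f.hom.hom x) :=
  ConcreteCategory.congr_hom (f.hom.comm g) x

theorem Cont.isOpen_setOf_act_eq (X : Cont G) (x y : X.obj.V) :
    IsOpen {g : G | X.obj.ρ g x = y} := by
  let : TopologicalSpace X.obj.V := ⊥
  have : DiscreteTopology X.obj.V := ⟨rfl⟩
  have hX : Continuous fun p : G × X.obj.V => X.obj.ρ p.1 p.2 := X.property
  have h : Continuous fun g : G => X.obj.ρ g x :=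
    hX.comp (by fun_prop : Continuous fun g : G => (g, x))
  exact (isOpen_discrete {y}).preimage h

theorem Cont.hom_ext {X Y : Cont G} {f g : X ⟶ Y} (h : ∀ x : X.obj.V, f.hom.hom x = g.hom.hom x) :
    f = g := by
  apply ObjectProperty.hom_ext
  apply Action.Hom.ext
  ext x
  exact h x

/-- An equivariant map, as a morphism of continuous `G`-sets. -/
def Cont.homMk {X Y : Cont G} (f : X.obj.V → Y.obj.V)
    (hf : ∀ g x, f (X.obj.ρ g x) = Y.obj.ρ g (f x)) : X ⟶ Y :=
  ObjectProperty.homMk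
    { hom := ↾f
      comm g := by
        ext x
        exact hf g x }

theorem Cont.homMk_apply {X Y : Cont G} (f : X.obj.V → Y.obj.V)
    (hf : ∀ g x, f (X.obj.ρ g x) = Y.obj.ρ g (f x)) (x : X.obj.V) :
    (Cont.homMk f hf).hom.hom x = f x := rfl

/-- The continuous `G`-set given by an action with open transporters. -/
def Cont.of (V : Type w) (a : G → V → V) (one : ∀ x, a 1 x = x)
    (mul : ∀ g h x, a (g * h) x = a g (a h x)) (h : ∀ x y, IsOpen {g : G | a g x = y}) : Cont G :=
  ⟨{ V := V
     ρ :=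
      { toFun g := ↾(a g)
        map_one' := ConcreteCategory.hom_ext (C := Type w) _ _ one
        map_mul' g h := ConcreteCategory.hom_ext (C := Type w) _ _ (mul g h) } },
    isContinuousAction_of_isOpen _ h⟩

theorem Cont.isIso_of_bijective {X Y : Cont G} (f : X ⟶ Y)
    (hf : Function.Bijective fun x : X.obj.V => f.hom.hom x) : IsIso f := by
  let e := Equiv.ofBijective _ hf
  refine ⟨Cont.homMk (fun y => e.symm y) (fun g y => ?_), Cont.hom_ext fun x => ?_,
    Cont.hom_ext fun y => ?_⟩
  · obtain ⟨x, rfl⟩ := e.surjective y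
    apply e.injective
    rw [e.apply_symm_apply, e.symm_apply_apply]
    exact (Cont.hom_act f g x).symm
  · exact e.symm_apply_apply x
  · exact e.apply_symm_apply y

end ContBasic

/-! ### Extending actions along a dense, topologically initial homomorphism -/

section Extend

variable {G H : Type w} [Group G] [TopologicalSpace G] [Group H] [TopologicalSpace H]
  (θ : G →ₜ* H)

open Filter

theorem comap_nhds_neBot_of_denseRange {X Y : Type*} [TopologicalSpace Y] {f : X → Y}
    (hf : DenseRange f) (y : Y) : (comap f (𝓝 y)).NeBot :=
  comap_neBot_iff.2 fun _ ht => by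
    obtain ⟨_, hy, x, rfl⟩ := mem_closure_iff_nhds.1 (hf y) _ ht
    exact ⟨x, hy⟩

/-- The relation "the elements of `G` that are close to `h` send `x` to `y`". -/
def Cont.ExtendsTo (X : Cont G) (h : H) (x y : X.obj.V) : Prop :=
  ∀ᶠ g in comap θ (𝓝 h), X.obj.ρ g x = y

variable {θ}

theorem Cont.ExtendsTo.unique (hd : DenseRange θ) {X : Cont G} {h : H} {x y z : X.obj.V}
    (hy : X.ExtendsTo θ h x y) (hz : X.ExtendsTo θ h x z) : y = z := by
  have := comap_nhds_neBot_of_denseRange hd h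
  obtain ⟨g, h1, h2⟩ := (hy.and hz).exists
  exact h1.symm.trans h2

/-- A Cauchy argument: the stabilizer of `x` contains the preimage of a neighbourhood `W` of 1, and
any two elements of G mapped close enough to `h` differ by an element of that preimage, so they move
`x` to the same point. Density provides at least one such element. -/
theorem Cont.exists_extendsTo [IsTopologicalGroup H] (hd : DenseRange θ) (hi : IsInducing θ)
    (X : Cont G) (h : H) (x : X.obj.V) : ∃ y, X.ExtendsTo θ h x y := by
  obtain ⟨W, hW, hWs⟩ : ∃ W ∈ 𝓝 (1 : H), θ ⁻¹' W ⊆ {g | X.obj.ρ g x = x} := by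
    have := (X.isOpen_setOf_act_eq x x).mem_nhds (X.one_act x)
    rwa [hi.nhds_eq_comap, map_one, mem_comap] at this
  have hc : Tendsto (fun p : H × H => p.1⁻¹ * p.2) (𝓝 h ×ˢ 𝓝 h) (𝓝 1) := by
    have : Continuous (fun p : H × H => p.1⁻¹ * p.2) := by fun_prop
    simpa [nhds_prod_eq] using this.tendsto (h, h)
  obtain ⟨O, hO, hOW⟩ := mem_prod_same_iff.1 (hc hW)
  have := comap_nhds_neBot_of_denseRange hd h
  have hO' : θ ⁻¹' O ∈ comap θ (𝓝 h) := preimage_mem_comap hO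
  obtain ⟨a, ha⟩ := nonempty_of_mem hO'
  refine ⟨X.obj.ρ a x, mem_of_superset hO' fun g hg => ?_⟩
  have h1 : X.obj.ρ (a⁻¹ * g) x = x := hWs <| by
    rw [Set.mem_preimage, map_mul, map_inv]
    exact hOW (show (θ a, θ g) ∈ O ×ˢ O from ⟨ha, hg⟩)
  change X.obj.ρ g x = X.obj.ρ a x
  conv_rhs => rw [← h1, ← X.mul_act, mul_inv_cancel_left]

theorem Cont.ExtendsTo.mul [IsTopologicalGroup H] (hd : DenseRange θ) (hi : IsInducing θ)
    {X : Cont G} {h k : H} {x y z : X.obj.V}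
    (hy : X.ExtendsTo θ k x y) (hz : X.ExtendsTo θ h y z) : X.ExtendsTo θ (h * k) x z := by
  obtain ⟨z', hz'⟩ := X.exists_extendsTo hd hi (h * k) x
  suffices z = z' from this ▸ hz'
  have := comap_nhds_neBot_of_denseRange hd h
  have := comap_nhds_neBot_of_denseRange hd k
  have ht : Tendsto (fun p : G × G => p.1 * p.2) (comap θ (𝓝 h) ×ˢ comap θ (𝓝 k))
      (comap θ (𝓝 (h * k))) := by
    rw [tendsto_comap_iff]
    have : (fun p : H × H => p.1 * p.2) ∘ Prod.map θ θ = θ ∘ fun p : G × G => p.1 * p.2 := by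
      ext p
      simp
    rw [← this]
    exact (tendsto_mul.mono_left (nhds_prod_eq.ge)).comp (tendsto_comap.prodMap tendsto_comap)
  -- Choose `a` near `h` and `b` near `k`, so that `a * b` is near `h * k` and all three limit
  -- values are attained at once.
  obtain ⟨⟨a, b⟩, h1, h2, h3⟩ := ((ht.eventually hz').and
    ((hz.prod_inl _).and (hy.prod_inr _))).exists
  dsimp only at h1 h2 h3
  rw [← h1, X.mul_act, h3, h2]

theorem Cont.ExtendsTo.isOpen {X : Cont G} (x y : X.obj.V) :
    IsOpen {h : H | X.ExtendsTo θ h x y} := by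
  rw [isOpen_iff_mem_nhds]
  intro h hh
  obtain ⟨O, hO, hOs⟩ := mem_comap.1 hh
  filter_upwards [eventually_mem_nhds_iff.2 hO] with k hk
  exact mem_of_superset (preimage_mem_comap hk) hOs

theorem Cont.ExtendsTo.map {X Y : Cont G} (f : X ⟶ Y) {h : H} {x y : X.obj.V}
    (hy : X.ExtendsTo θ h x y) : Y.ExtendsTo θ h (f.hom.hom x) (f.hom.hom y) := by
  filter_upwards [hy] with g hg
  rw [← hg, Cont.hom_act]

/-- Equivariance under `h` is tested at one point `x` at a time; transporters are open, so by
density some element of G acts like `h` on both `x` and its image. -/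
theorem Cont.res_full (hd : DenseRange θ) : (Cont.res θ).Full where
  map_surjective {X Y} f := by
    refine ⟨Cont.homMk (fun x => f.hom.hom x) fun h x => ?_, rfl⟩
    obtain ⟨h', ⟨h1, h2⟩, g, rfl⟩ := hd.inter_open_nonempty
      ({k : H | X.obj.ρ k x = X.obj.ρ h x} ∩
        {k : H | Y.obj.ρ k (f.hom.hom x) = Y.obj.ρ h (f.hom.hom x)})
      ((X.isOpen_setOf_act_eq _ _).inter (Y.isOpen_setOf_act_eq _ _)) ⟨h, rfl, rfl⟩
    rw [Set.mem_ofPred_eq] at h1 h2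
    rw [← h1, ← h2]
    exact Cont.hom_act f g x

theorem Cont.res_faithful : (Cont.res θ).Faithful where
  map_injective {X Y _ _} e := Cont.hom_ext fun x =>
    congrArg (fun k : (Cont.res θ).obj X ⟶ (Cont.res θ).obj Y => k.hom.hom x) e

variable [IsTopologicalGroup H] (hd : DenseRange θ) (hi : IsInducing θ)

/-- The extension to `H` of an action of a dense subgroup `G` with the induced topology. -/
noncomputable def Cont.extendAct (X : Cont G) (h : H) (x : X.obj.V) : X.obj.V :=
  (X.exists_extendsTo hd hi h x).choose

theorem Cont.extendsTo_extendAct (X : Cont G) (h : H) (x : X.obj.V) :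
    X.ExtendsTo θ h x (X.extendAct hd hi h x) :=
  (X.exists_extendsTo hd hi h x).choose_spec

theorem Cont.extendAct_eq_iff (X : Cont G) (h : H) (x y : X.obj.V) :
    X.extendAct hd hi h x = y ↔ X.ExtendsTo θ h x y :=
  ⟨fun e => e ▸ X.extendsTo_extendAct hd hi h x,
    fun e => (X.extendsTo_extendAct hd hi h x).unique hd e⟩

theorem Cont.extendAct_map (X : Cont G) (g : G) (x : X.obj.V) :
    X.extendAct hd hi (θ g) x = X.obj.ρ g x := by
  rw [X.extendAct_eq_iff]
  have := (X.isOpen_setOf_act_eq x (X.obj.ρ g x)).mem_nhds rfl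
  rwa [hi.nhds_eq_comap] at this

theorem Cont.extendAct_one (X : Cont G) (x : X.obj.V) : X.extendAct hd hi 1 x = x := by
  rw [← map_one θ, X.extendAct_map, X.one_act]

theorem Cont.extendAct_mul (X : Cont G) (h k : H) (x : X.obj.V) :
    X.extendAct hd hi (h * k) x = X.extendAct hd hi h (X.extendAct hd hi k x) :=
  (X.extendAct_eq_iff hd hi _ _ _).2
    ((X.extendsTo_extendAct hd hi k x).mul hd hi (X.extendsTo_extendAct hd hi h _))

theorem Cont.isOpen_setOf_extendAct_eq (X : Cont G) (x y : X.obj.V) :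
    IsOpen {h : H | X.extendAct hd hi h x = y} := by
  simp_rw [Cont.extendAct_eq_iff]
  exact Cont.ExtendsTo.isOpen x y

theorem Cont.hom_extendAct {X Y : Cont G} (f : X ⟶ Y) (h : H) (x : X.obj.V) :
    f.hom.hom (X.extendAct hd hi h x) = Y.extendAct hd hi h (f.hom.hom x) :=
  ((Y.extendAct_eq_iff hd hi _ _ _).2 ((X.extendsTo_extendAct hd hi h x).map f)).symm

/-- The canonical action of `H` on the canonical point of `Cont G`, when `G` is dense in `H`. -/
noncomputable def extendToPointAut : H →* PointAut G where
  toFun h := NatIso.ofComponents (F := Cont.forget G) (G := Cont.forget G)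
    (fun X =>
      { hom := ↾(X.extendAct hd hi h)
        inv := ↾(X.extendAct hd hi h⁻¹)
        hom_inv_id := ConcreteCategory.hom_ext (C := Type w) _ _ fun x =>
          (X.extendAct_mul hd hi h⁻¹ h x).symm.trans
            (by rw [inv_mul_cancel]; exact X.extendAct_one hd hi x)
        inv_hom_id := ConcreteCategory.hom_ext (C := Type w) _ _ fun x =>
          (X.extendAct_mul hd hi h h⁻¹ x).symm.trans
            (by rw [mul_inv_cancel]; exact X.extendAct_one hd hi x) })
    (fun f => ConcreteCategory.hom_ext (C := Type w) _ _ fun x =>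
      (Cont.hom_extendAct hd hi f h x).symm)
  map_one' := by
    apply Iso.ext
    ext X x
    exact X.extendAct_one hd hi x
  map_mul' h k := by
    apply Iso.ext
    ext X x
    exact X.extendAct_mul hd hi h k x

theorem extendToPointAut_act (h : H) (X : Cont G) (x : X.obj.V) :
    (extendToPointAut hd hi h).act X x = X.extendAct hd hi h x := rfl

theorem PointAut.ext {α β : PointAut G} (h : ∀ (X : Cont G) (x : X.obj.V), α.act X x = β.act X x) :
    α = β := by
  apply Iso.ext
  ext X x
  exact h X x

theorem PointAut.mul_act (α β : PointAut G) (X : Cont G) (x : X.obj.V) :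
    (α * β).act X x = α.act X (β.act X x) := rfl

theorem PointAut.act_naturality (α : PointAut G) {X Y : Cont G} (f : X ⟶ Y) (x : X.obj.V) :
    α.act Y (f.hom.hom x) = f.hom.hom (α.act X x) :=
  ConcreteCategory.congr_hom ((Iso.hom (C := Cont G ⥤ Type w) α).naturality f) x

theorem extendToPointAut_map (g : G) : extendToPointAut hd hi (θ g) = toPointAut G g :=
  PointAut.ext fun X x => X.extendAct_map hd hi g x

end Extend

theorem Cont.res_isEquivalence {G H : Type w} [Group G] [TopologicalSpace G] [Group H]
    [TopologicalSpace H] {θ : G →ₜ* H} [IsTopologicalGroup H] (hd : DenseRange θ)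
    (hi : IsInducing θ) :
    (Cont.res θ).IsEquivalence where
  full := Cont.res_full hd
  faithful := Cont.res_faithful
  essSurj := ⟨fun X => by
    let Y : Cont H := Cont.of X.obj.V (X.extendAct hd hi) (X.extendAct_one hd hi)
      (X.extendAct_mul hd hi) (X.isOpen_setOf_extendAct_eq hd hi)
    let f : (Cont.res θ).obj Y ⟶ X := Cont.homMk (fun x => x) fun g x => X.extendAct_map hd hi g x
    have := Cont.isIso_of_bijective f Function.bijective_id
    exact ⟨Y, ⟨asIso f⟩⟩⟩

/-! ### Topologies generated by cosets -/

theorem isTopologicalBasis_cosets {G : Type*} [Group G] {B : Set (Subgroup G)} (hB : B.Nonempty)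
    (inter : ∀ N ∈ B, ∀ M ∈ B, ∃ P ∈ B, P ≤ N ⊓ M) :
    @TopologicalSpace.IsTopologicalBasis G (cosetTopology B)
      {S | ∃ N ∈ B, ∃ g : G, S = {h | g⁻¹ * h ∈ N}} := by
  let : TopologicalSpace G := cosetTopology B
  refine ⟨?_, ?_, rfl⟩
  · rintro _ ⟨N, hN, g, rfl⟩ _ ⟨M, hM, k, rfl⟩ x ⟨hx₁, hx₂⟩
    obtain ⟨P, hP, hle⟩ := inter N hN M hM
    refine ⟨{h | x⁻¹ * h ∈ P}, ⟨P, hP, x, rfl⟩, by simp [P.one_mem], fun y hy => ⟨?_, ?_⟩⟩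
    · simpa [mul_assoc] using N.mul_mem hx₁ (hle hy).1
    · simpa [mul_assoc] using M.mul_mem hx₂ (hle hy).2
  · obtain ⟨N, hN⟩ := hB
    exact Set.eq_univ_of_forall fun x =>
      ⟨{h | x⁻¹ * h ∈ N}, ⟨N, hN, x, rfl⟩, by simp [N.one_mem]⟩

theorem mem_nhds_cosetTopology_iff {G : Type*} [Group G] {B : Set (Subgroup G)} (hB : B.Nonempty)
    (inter : ∀ N ∈ B, ∀ M ∈ B, ∃ P ∈ B, P ≤ N ⊓ M) (g : G) (S : Set G) :
    S ∈ @nhds G (cosetTopology B) g ↔ ∃ N ∈ B, {h | g⁻¹ * h ∈ N} ⊆ S := by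
  let : TopologicalSpace G := cosetTopology B
  rw [(isTopologicalBasis_cosets hB inter).mem_nhds_iff]
  constructor
  · rintro ⟨_, ⟨N, hN, k, rfl⟩, hg, hS⟩
    refine ⟨N, hN, fun h hh => hS ?_⟩
    simpa [mul_assoc] using N.mul_mem hg hh
  · rintro ⟨N, hN, hS⟩
    exact ⟨_, ⟨N, hN, g, rfl⟩, by simp [N.one_mem], hS⟩

theorem isAlgebraicBase_cosetTopology {G : Type*} [Group G] {B : Set (Subgroup G)}
    (hB : B.Nonempty) (inter : ∀ N ∈ B, ∀ M ∈ B, ∃ P ∈ B, P ≤ N ⊓ M)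
    (conj : ∀ N ∈ B, ∀ g : G, N.map (MulAut.conj g).toMonoidHom ∈ B) :
    @IsAlgebraicBase G _ (cosetTopology B) B := by
  let : TopologicalSpace G := cosetTopology B
  have hn := mem_nhds_cosetTopology_iff hB inter
  have hconj : ∀ N ∈ B, ∀ g : G, ∃ M ∈ B, ∀ x ∈ M, g * x * g⁻¹ ∈ N := fun N hN g => by
    refine ⟨_, conj N hN g⁻¹, ?_⟩
    rintro _ ⟨x, hx, rfl⟩
    simpa [mul_assoc] using hx
  refine ⟨{ continuous_mul := ?_, continuous_inv := ?_ }, ⟨fun S => ?_⟩, inter, conj⟩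
  · refine continuous_generateFrom_iff.2 ?_
    rintro _ ⟨N, hN, g, rfl⟩
    rw [isOpen_iff_mem_nhds]
    rintro ⟨a, b⟩ hab
    -- With x = am and y = bn, one has g⁻¹xy = (g⁻¹ab)(b⁻¹mb)n, so `M` must be conjugated into `N`
    -- by b⁻¹.
    obtain ⟨M, hM, hMN⟩ := hconj N hN b⁻¹
    rw [mem_nhds_prod_iff]
    refine ⟨_, (hn a _).2 ⟨M, hM, subset_rfl⟩, _, (hn b _).2 ⟨N, hN, subset_rfl⟩, ?_⟩
    rintro ⟨x, y⟩ ⟨hx, hy⟩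
    simpa [mul_assoc] using N.mul_mem (N.mul_mem hab (hMN _ hx)) hy
  · refine continuous_generateFrom_iff.2 ?_
    rintro _ ⟨N, hN, g, rfl⟩
    rw [isOpen_iff_mem_nhds]
    intro a ha
    obtain ⟨M, hM, hMN⟩ := hconj N hN a
    refine (hn a _).2 ⟨M, hM, fun x hx => ?_⟩
    simpa [mul_assoc] using N.mul_mem ha (N.inv_mem (hMN _ hx))
  · rw [hn]
    simp only [inv_one, one_mul]
    rfl

/-! ### Homogeneous objects -/

section Homogeneous

variable {C : Type w} [SmallCategory C] {D : Type u} [Category.{w} D] {ι : C ⥤ D} {U : D}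

variable (ι U) in
/-- `U` is universal and ultrahomogeneous, the arrows to `U` are directed, and they separate the
arrows of `C`. -/
structure IsHomogeneous : Prop where
  universal : IsUniversal ι U
  ultrahomogeneous : IsUltrahomogeneous ι U
  directed : ∀ (a b : C) (ξ : ι.obj a ⟶ U) (χ : ι.obj b ⟶ U),
    ∃ (c : C) (f : a ⟶ c) (g : b ⟶ c) (ε : ι.obj c ⟶ U), ι.map f ≫ ε = ξ ∧ ι.map g ≫ ε = χ
  separating : ∀ (a b : C) (f g : a ⟶ b) (χ : ι.obj b ⟶ U),
    ι.map f ≫ χ = ι.map g ≫ χ → f = g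

theorem AutGroup.ext {g h : AutGroup ι U} (e : g.hom = h.hom) : g = h :=
  Iso.ext e

theorem AutGroup.hom_inv_hom (g : AutGroup ι U) : g.hom ≫ (g⁻¹).hom = 𝟙 U := by
  rw [← AutGroup.mul_hom, inv_mul_cancel, AutGroup.one_hom]

/-- Postcomposition with an automorphism. -/
def AutGroup.postcompEquiv (g : AutGroup ι U) (c : C) : (ι.obj c ⟶ U) ≃ (ι.obj c ⟶ U) :=
  Iso.homToEquiv (X := U) (Y := U) g

theorem AutGroup.postcompEquiv_map_comp (g : AutGroup ι U) {c d : C} (f : c ⟶ d)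
    (ξ : ι.obj d ⟶ U) :
    g.postcompEquiv c (ι.map f ≫ ξ) = ι.map f ≫ g.postcompEquiv d ξ :=
  Category.assoc (ι.map f) ξ g.hom

theorem AutGroup.mem_stabilizer {c : C} {χ : ι.obj c ⟶ U} {g : AutGroup ι U} :
    g ∈ AutGroup.stabilizer χ ↔ χ ≫ g.hom = χ := Iff.rfl

theorem AutGroup.inv_mul_mem_stabilizer {c : C} {χ : ι.obj c ⟶ U} {g h : AutGroup ι U} :
    g⁻¹ * h ∈ AutGroup.stabilizer χ ↔ χ ≫ h.hom = χ ≫ g.hom := by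
  rw [AutGroup.mem_stabilizer, AutGroup.mul_hom]
  constructor
  · intro e
    conv_rhs => rw [← e]
    simp only [Category.assoc]
    rw [← AutGroup.mul_hom, mul_inv_cancel, AutGroup.one_hom, Category.comp_id]
  · intro e
    rw [← Category.assoc, e, Category.assoc, AutGroup.hom_inv_hom, Category.comp_id]

theorem AutGroup.map_conj_stabilizer {c : C} (χ : ι.obj c ⟶ U) (g : AutGroup ι U) :
    (AutGroup.stabilizer χ).map (MulAut.conj g).toMonoidHom = AutGroup.stabilizer (χ ≫ g.hom) := by
  ext k
  rw [Subgroup.mem_map_equiv, AutGroup.mem_stabilizer, MulAut.conj_symm_apply, mul_assoc,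
    ← AutGroup.mem_stabilizer, AutGroup.inv_mul_mem_stabilizer, AutGroup.mem_stabilizer,
    AutGroup.mul_hom, Category.assoc]

namespace IsHomogeneous

theorem exists_comp_hom_eq (h : IsHomogeneous ι U) {c : C} (χ χ' : ι.obj c ⟶ U) :
    ∃ g : AutGroup ι U, χ ≫ g.hom = χ' := by
  obtain ⟨φ, e⟩ := h.ultrahomogeneous (𝟙 c) χ χ'
  rw [ι.map_id, Category.id_comp] at e
  exact ⟨φ, e⟩

theorem jointEmbedding (h : IsHomogeneous ι U) : JointEmbeddingProperty C := fun a b => by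
  obtain ⟨ξ⟩ := h.universal a
  obtain ⟨χ⟩ := h.universal b
  obtain ⟨c, f, g, -⟩ := h.directed a b ξ χ
  exact ⟨c, ⟨f⟩, ⟨g⟩⟩

/-- The square is first completed over `U`: an automorphism makes the two composites from `a` to `U`
agree. Directedness brings the resulting arrows to `U` back to an object `d` of C, and separation
makes the square commute there. -/
theorem amalgamation (h : IsHomogeneous ι U) : AmalgamationProperty C := fun a b c f g => by
  obtain ⟨ψ⟩ := h.universal b
  obtain ⟨χ⟩ := h.universal c
  obtain ⟨φ, e⟩ := h.exists_comp_hom_eq (ι.map f ≫ ψ) (ι.map g ≫ χ)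
  obtain ⟨d, f', g', ε, e₁, e₂⟩ := h.directed b c (ψ ≫ φ.hom) χ
  refine ⟨d, f', g', h.separating _ _ _ _ ε ?_⟩
  rw [ι.map_comp, ι.map_comp, Category.assoc, Category.assoc, e₁, e₂, ← e, Category.assoc]

theorem exists_stabilizer_le (h : IsHomogeneous ι U) {N M : Subgroup (AutGroup ι U)}
    (hN : N ∈ stabilizers ι U) (hM : M ∈ stabilizers ι U) :
    ∃ P ∈ stabilizers ι U, P ≤ N ⊓ M := by
  obtain ⟨a, ξ, rfl⟩ := hN
  obtain ⟨b, χ, rfl⟩ := hM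
  obtain ⟨c, f, g, ε, rfl, rfl⟩ := h.directed a b ξ χ
  refine ⟨_, ⟨c, ε, rfl⟩, fun k hk => ?_⟩
  rw [AutGroup.mem_stabilizer] at hk
  rw [Subgroup.mem_inf, AutGroup.mem_stabilizer, AutGroup.mem_stabilizer]
  simp only [Category.assoc, hk, and_self]

theorem stabilizers_nonempty [Nonempty C] (h : IsHomogeneous ι U) :
    (stabilizers ι U).Nonempty := by
  obtain ⟨c⟩ := ‹Nonempty C›
  obtain ⟨ξ⟩ := h.universal c
  exact ⟨_, c, ξ, rfl⟩

theorem isAlgebraicBase [Nonempty C] (h : IsHomogeneous ι U) :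
    IsAlgebraicBase (stabilizers ι U) := by
  refine isAlgebraicBase_cosetTopology h.stabilizers_nonempty
    (fun N hN M hM => h.exists_stabilizer_le hN hM) ?_
  rintro _ ⟨c, χ, rfl⟩ g
  exact ⟨c, χ ≫ g.hom, AutGroup.map_conj_stabilizer χ g⟩

theorem mem_nhds_iff [Nonempty C] (h : IsHomogeneous ι U) (g : AutGroup ι U)
    (S : Set (AutGroup ι U)) :
    S ∈ 𝓝 g ↔ ∃ (c : C) (χ : ι.obj c ⟶ U), {k : AutGroup ι U | χ ≫ k.hom = χ ≫ g.hom} ⊆ S := by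
  refine (mem_nhds_cosetTopology_iff h.stabilizers_nonempty
    (fun N hN M hM => h.exists_stabilizer_le hN hM) g S).trans ?_
  simp only [← AutGroup.inv_mul_mem_stabilizer]
  constructor
  · rintro ⟨_, ⟨c, χ, rfl⟩, hS⟩
    exact ⟨c, χ, hS⟩
  · rintro ⟨c, χ, hS⟩
    exact ⟨_, ⟨c, χ, rfl⟩, hS⟩

theorem isFiltered [Nonempty C] (h : IsHomogeneous ι U) : IsFiltered (CostructuredArrow ι U) where
  nonempty := by
    obtain ⟨c⟩ := ‹Nonempty C›
    obtain ⟨ξ⟩ := h.universal c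
    exact ⟨CostructuredArrow.mk ξ⟩
  cocone_objs X Y := by
    obtain ⟨c, f, g, ε, e₁, e₂⟩ := h.directed _ _ X.hom Y.hom
    exact ⟨CostructuredArrow.mk ε, CostructuredArrow.homMk f e₁, CostructuredArrow.homMk g e₂,
      trivial⟩
  cocone_maps X Y f g := by
    -- Parallel arrows over `U` are already equal by separation, so the identity coequalizes them.
    refine ⟨Y, 𝟙 Y, ?_⟩
    congr 1
    apply CostructuredArrow.hom_ext
    apply h.separating _ _ _ _ Y.hom
    rw [CostructuredArrow.w, CostructuredArrow.w]

end IsHomogeneous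

end Homogeneous

/-! ### The associated ind-object -/

section IndObject

variable {C : Type w} [SmallCategory C]

/-- Arrows in `Ind C` from an object of `C` are the sections of the underlying presheaf. -/
noncomputable def indYonedaCoyonedaIso (c : C) :
    coyoneda.obj (op (Ind.yoneda.obj c)) ≅
      Ind.inclusion C ⋙ (evaluation Cᵒᵖ (Type w)).obj (op c) :=
  NatIso.ofComponents
    (fun X => ((Ind.inclusion.fullyFaithful.homEquiv.trans
      ((Ind.yonedaCompInclusion.app c).homFromEquiv)).trans yonedaEquiv).toIso)
    (fun {X Y} f => by
      ext χ
      simp [yonedaEquiv, Functor.FullyFaithful.homEquiv])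

/-- Objects of C are compact in Ind-C: filtered colimits of ind-objects are computed on underlying
presheaves, and evaluation preserves them. -/
instance (c : C) {J : Type w} [SmallCategory J] [IsFiltered J] :
    PreservesColimitsOfShape J (coyoneda.obj (op (Ind.yoneda.obj c))) :=
  preservesColimitsOfShape_of_natIso (indYonedaCoyonedaIso c).symm

variable {D : Type u} [Category.{w} D] {ι : C ⥤ D} {U : D}
  {t : Cocone (CostructuredArrow.proj ι U ⋙ Ind.yoneda)}

variable (t) in
/-- The colimit arrow of a cocone under `C/U`. -/
abbrev indArrow {c : C} (ξ : ι.obj c ⟶ U) : Ind.yoneda.obj c ⟶ t.pt :=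
  t.ι.app (CostructuredArrow.mk ξ)

theorem map_comp_indArrow {c d : C} (f : c ⟶ d) (ξ : ι.obj d ⟶ U) :
    Ind.yoneda.map f ≫ indArrow t ξ = indArrow t (ι.map f ≫ ξ) :=
  t.w (CostructuredArrow.homMk f rfl : CostructuredArrow.mk (ι.map f ≫ ξ) ⟶ CostructuredArrow.mk ξ)

namespace IsHomogeneous

theorem bijective_indArrow [Nonempty C] (h : IsHomogeneous ι U) (ht : IsColimit t) (c : C) :
    Function.Bijective (indArrow t : (ι.obj c ⟶ U) → (Ind.yoneda.obj c ⟶ t.pt)) := by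
  have := h.isFiltered
  have hc := isColimitOfPreserves (coyoneda.obj (op (Ind.yoneda.obj c))) ht
  constructor
  · intro ξ ξ' e
    -- `indArrow t ξ` is represented by the identity of `c` at the stage `ξ`. Equality in the
    -- filtered colimit yields arrows `f`, `g` over `U` to a common stage with the same underlying
    -- arrow of C, and this arrow recovers both `ξ` and `ξ'`.
    obtain ⟨k, f, g, e'⟩ := (Types.FilteredColimit.isColimit_eq_iff _ hc
      (i := CostructuredArrow.mk ξ) (j := CostructuredArrow.mk ξ') (xi := 𝟙 _) (xj := 𝟙 _)).1
      ((Category.id_comp _).trans (e.trans (Category.id_comp _).symm))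
    have e₁ : f.left = g.left := Ind.yoneda.map_injective <|
      (Category.id_comp (Ind.yoneda.map f.left)).symm.trans
        (e'.trans (Category.id_comp (Ind.yoneda.map g.left)))
    rw [← show _ = ξ from CostructuredArrow.w f, ← show _ = ξ' from CostructuredArrow.w g, e₁]
  · intro χ
    obtain ⟨k, x, e⟩ := Types.jointly_surjective _ hc χ
    obtain ⟨f, rfl⟩ := Ind.yoneda.map_surjective x
    exact ⟨ι.map f ≫ k.hom, (map_comp_indArrow f k.hom).symm.trans e⟩

theorem indArrow_injective [Nonempty C] (h : IsHomogeneous ι U) (ht : IsColimit t) {c : C}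
    {ξ ξ' : ι.obj c ⟶ U} (e : indArrow t ξ = indArrow t ξ') : ξ = ξ' :=
  (h.bijective_indArrow ht c).1 e

theorem exists_indArrow_eq [Nonempty C] (h : IsHomogeneous ι U) (ht : IsColimit t) {c : C}
    (χ : Ind.yoneda.obj c ⟶ t.pt) : ∃ ξ : ι.obj c ⟶ U, indArrow t ξ = χ :=
  (h.bijective_indArrow ht c).2 χ

end IsHomogeneous

theorem indArrow_hom_ext (ht : IsColimit t) {X : Ind C} {f g : t.pt ⟶ X}
    (h : ∀ (c : C) (ξ : ι.obj c ⟶ U), indArrow t ξ ≫ f = indArrow t ξ ≫ g) : f = g :=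
  ht.hom_ext fun x => h x.left x.hom

/-- The endomorphism of the ind-object induced by an automorphism of the presheaf of arrows
to `U`. -/
def indDesc (ht : IsColimit t) (φ : ∀ c : C, (ι.obj c ⟶ U) → (ι.obj c ⟶ U))
    (hφ : ∀ (c d : C) (f : c ⟶ d) (ξ : ι.obj d ⟶ U), φ c (ι.map f ≫ ξ) = ι.map f ≫ φ d ξ) :
    t.pt ⟶ t.pt :=
  ht.desc
    { pt := t.pt
      ι :=
        { app x := indArrow t (φ x.left x.hom)
          naturality x y f := by
            have := map_comp_indArrow (t := t) f.left (φ y.left y.hom)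
            rw [← hφ, CostructuredArrow.w] at this
            exact this.trans (Category.comp_id _).symm } }

theorem indArrow_indDesc (ht : IsColimit t) (φ : ∀ c : C, (ι.obj c ⟶ U) → (ι.obj c ⟶ U))
    (hφ : ∀ (c d : C) (f : c ⟶ d) (ξ : ι.obj d ⟶ U), φ c (ι.map f ≫ ξ) = ι.map f ≫ φ d ξ)
    {c : C} (ξ : ι.obj c ⟶ U) :
    indArrow t ξ ≫ indDesc ht φ hφ = indArrow t (φ c ξ) :=
  ht.fac _ _

/-- The automorphism of the ind-object induced by an automorphism of the presheaf of arrows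
to `U`. -/
def indAut (ht : IsColimit t) (φ : ∀ c : C, (ι.obj c ⟶ U) ≃ (ι.obj c ⟶ U))
    (hφ : ∀ (c d : C) (f : c ⟶ d) (ξ : ι.obj d ⟶ U), φ c (ι.map f ≫ ξ) = ι.map f ≫ φ d ξ) :
    AutGroup Ind.yoneda t.pt where
  hom := indDesc ht (fun c => φ c) hφ
  inv := indDesc ht (fun c => (φ c).symm) fun c d f ξ => by
    rw [Equiv.symm_apply_eq, hφ, Equiv.apply_symm_apply]
  hom_inv_id := indArrow_hom_ext ht fun c ξ => by
    rw [← Category.assoc, indArrow_indDesc, indArrow_indDesc, Equiv.symm_apply_apply,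
      Category.comp_id]
  inv_hom_id := indArrow_hom_ext ht fun c ξ => by
    rw [← Category.assoc, indArrow_indDesc, indArrow_indDesc, Equiv.apply_symm_apply,
      Category.comp_id]

theorem indArrow_indAut (ht : IsColimit t) (φ : ∀ c : C, (ι.obj c ⟶ U) ≃ (ι.obj c ⟶ U))
    (hφ : ∀ (c d : C) (f : c ⟶ d) (ξ : ι.obj d ⟶ U), φ c (ι.map f ≫ ξ) = ι.map f ≫ φ d ξ)
    {c : C} (ξ : ι.obj c ⟶ U) :
    indArrow t ξ ≫ (indAut ht φ hφ).hom = indArrow t (φ c ξ) :=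
  indArrow_indDesc ht _ hφ ξ

/-- The automorphism of the ind-object induced by an automorphism of `U`. -/
def indAutOf (ht : IsColimit t) (g : AutGroup ι U) : AutGroup Ind.yoneda t.pt :=
  indAut ht g.postcompEquiv fun _ _ f ξ => g.postcompEquiv_map_comp f ξ

theorem indArrow_indAutOf (ht : IsColimit t) (g : AutGroup ι U) {c : C} (ξ : ι.obj c ⟶ U) :
    indArrow t ξ ≫ (indAutOf ht g).hom = indArrow t (ξ ≫ g.hom) :=
  indArrow_indAut ht _ (fun _ _ f ξ => g.postcompEquiv_map_comp f ξ) ξ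

/-- The homomorphism from the automorphisms of `U` to the automorphisms of the ind-object. -/
def autToInd (ht : IsColimit t) : AutGroup ι U →* AutGroup Ind.yoneda t.pt where
  toFun g := indAutOf ht g
  map_one' := AutGroup.ext <| indArrow_hom_ext ht fun c ξ => by
    rw [indArrow_indAutOf, AutGroup.one_hom, AutGroup.one_hom, Category.comp_id, Category.comp_id]
  map_mul' g h := AutGroup.ext <| indArrow_hom_ext ht fun c ξ => by
    rw [indArrow_indAutOf, AutGroup.mul_hom, AutGroup.mul_hom, ← Category.assoc, ← Category.assoc,
      indArrow_indAutOf, indArrow_indAutOf]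

theorem indArrow_autToInd (ht : IsColimit t) (g : AutGroup ι U) {c : C} (ξ : ι.obj c ⟶ U) :
    indArrow t ξ ≫ (autToInd ht g).hom = indArrow t (ξ ≫ g.hom) :=
  indArrow_indAutOf ht g ξ

namespace IsHomogeneous

/-- The four conditions speak only of arrows out of objects of C, and those correspond naturally;
automorphisms of `U` provide the ones required of the ind-object. -/
theorem ind [Nonempty C] (h : IsHomogeneous ι U) (ht : IsColimit t) :
    IsHomogeneous Ind.yoneda t.pt where
  universal c := (h.universal c).map (indArrow t)
  ultrahomogeneous a b j χ₁ χ₂ := by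
    obtain ⟨ξ₁, rfl⟩ := h.exists_indArrow_eq ht χ₁
    obtain ⟨ξ₂, rfl⟩ := h.exists_indArrow_eq ht χ₂
    obtain ⟨g, hg⟩ := h.exists_comp_hom_eq ξ₁ (ι.map j ≫ ξ₂)
    refine ⟨(autToInd ht g : AutGroup Ind.yoneda t.pt), ?_⟩
    rw [map_comp_indArrow, ← hg]
    exact indArrow_autToInd ht g ξ₁
  directed a b ξ χ := by
    obtain ⟨ξ, rfl⟩ := h.exists_indArrow_eq ht ξ
    obtain ⟨χ, rfl⟩ := h.exists_indArrow_eq ht χ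
    obtain ⟨c, f, g, ε, rfl, rfl⟩ := h.directed a b ξ χ
    exact ⟨c, f, g, indArrow t ε, map_comp_indArrow f ε, map_comp_indArrow g ε⟩
  separating a b f g χ e := by
    obtain ⟨χ, rfl⟩ := h.exists_indArrow_eq ht χ
    rw [map_comp_indArrow, map_comp_indArrow] at e
    exact h.separating _ _ _ _ _ (h.indArrow_injective ht e)

theorem isInducing_autToInd [Nonempty C] (h : IsHomogeneous ι U) (ht : IsColimit t) :
    IsInducing (autToInd ht : AutGroup ι U → AutGroup Ind.yoneda t.pt) := by
  have key : ∀ {c : C} (χ : ι.obj c ⟶ U) (g k : AutGroup ι U),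
      indArrow t χ ≫ (autToInd ht k).hom = indArrow t χ ≫ (autToInd ht g).hom ↔
        χ ≫ k.hom = χ ≫ g.hom := fun χ g k => by
    rw [indArrow_autToInd, indArrow_autToInd]
    exact ⟨h.indArrow_injective ht, congrArg _⟩
  rw [isInducing_iff_nhds]
  intro g
  ext S
  rw [h.mem_nhds_iff, Filter.mem_comap]
  constructor
  · rintro ⟨c, χ, hS⟩
    refine ⟨_, ((h.ind ht).mem_nhds_iff _ _).2 ⟨c, indArrow t χ, subset_rfl⟩, fun k hk => hS ?_⟩
    exact (key χ g k).1 hk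
  · rintro ⟨T, hT, hTS⟩
    obtain ⟨c, χ, hT⟩ := ((h.ind ht).mem_nhds_iff _ _).1 hT
    obtain ⟨χ, rfl⟩ := h.exists_indArrow_eq ht χ
    exact ⟨c, χ, fun k hk => hTS (hT ((key χ g k).2 hk))⟩

theorem denseRange_autToInd [Nonempty C] (h : IsHomogeneous ι U) (ht : IsColimit t) :
    DenseRange (autToInd ht : AutGroup ι U → AutGroup Ind.yoneda t.pt) := by
  intro k
  rw [mem_closure_iff_nhds]
  intro S hS
  obtain ⟨c, χ, hS⟩ := ((h.ind ht).mem_nhds_iff _ _).1 hS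
  obtain ⟨χ, rfl⟩ := h.exists_indArrow_eq ht χ
  obtain ⟨χ', hχ'⟩ := h.exists_indArrow_eq ht (indArrow t χ ≫ k.hom)
  -- Approximating `k` near one arrow only requires an automorphism of `U` with the same effect on
  -- that arrow, which transitivity supplies.
  obtain ⟨g, rfl⟩ := h.exists_comp_hom_eq χ χ'
  exact ⟨autToInd ht g, hS ((indArrow_autToInd ht g χ).trans hχ'), g, rfl⟩

end IsHomogeneous

end IndObject

/-! ### The completion of the automorphism group -/

section Completion

/-- The action of an automorphism of the canonical point, as a permutation. -/
def PointAut.equiv {G : Type w} [Group G] [TopologicalSpace G] (α : PointAut G) (X : Cont G) :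
    X.obj.V ≃ X.obj.V where
  toFun := α.act X
  invFun := (α⁻¹).act X
  left_inv x := by
    rw [← PointAut.mul_act, inv_mul_cancel]
    rfl
  right_inv x := by
    rw [← PointAut.mul_act, mul_inv_cancel]
    rfl

theorem PointAut.inv_mul_mem_stabilizer {G : Type w} [Group G] [TopologicalSpace G]
    {α β : PointAut G} {X : Cont G} {x : X.obj.V} :
    α⁻¹ * β ∈ PointAut.stabilizer X x ↔ β.act X x = α.act X x :=
  (α.equiv X).symm_apply_eq (x := β.act X x) (y := x)

variable {C : Type w} [SmallCategory C] {D : Type u} [Category.{w} D] {ι : C ⥤ D} {U : D}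

/-- The arrows from `c` to `U` are the elements of `homFunctor ι U` at `c`. -/
def homElt (c : C) : (ι.obj c ⟶ U) ≃ ((homFunctor ι U).obj (op c)).obj.V := Equiv.refl _

theorem act_homElt {c : C} (g : AutGroup ι U) (χ : ι.obj c ⟶ U) :
    ((homFunctor ι U).obj (op c)).obj.ρ g (homElt c χ) = homElt c (χ ≫ g.hom) := rfl

namespace IsHomogeneous

/-- By continuity the stabilizer of `x` contains that of some `χ`. The arrows from `c` to `U` form
the orbit of `χ`, so sending `χ` to `x` extends to an equivariant map. These maps generate all
continuous actions from the sets of arrows. -/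
theorem exists_hom_apply_eq [Nonempty C] (h : IsHomogeneous ι U) (X : Cont (AutGroup ι U))
    (x : X.obj.V) : ∃ (c : C) (χ : ι.obj c ⟶ U) (f : (homFunctor ι U).obj (op c) ⟶ X),
      f.hom.hom (homElt c χ) = x := by
  obtain ⟨c, χ, hχ⟩ := (h.mem_nhds_iff 1 _).1 ((X.isOpen_setOf_act_eq x x).mem_nhds (X.one_act x))
  have key : ∀ g k : AutGroup ι U, χ ≫ g.hom = χ ≫ k.hom → X.obj.ρ g x = X.obj.ρ k x := by
    intro g k e
    have : X.obj.ρ (k⁻¹ * g) x = x := hχ <| by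
      rw [Set.mem_ofPred_eq, AutGroup.one_hom, Category.comp_id]
      exact AutGroup.inv_mul_mem_stabilizer.2 e
    conv_rhs => rw [← this, ← X.mul_act, mul_inv_cancel_left]
  choose s hs using fun ξ : ι.obj c ⟶ U => h.exists_comp_hom_eq χ ξ
  refine ⟨c, χ, Cont.homMk (fun ξ => X.obj.ρ (s ((homElt c).symm ξ)) x) (fun g ξ => ?_), ?_⟩
  · obtain ⟨ξ, rfl⟩ := (homElt c).surjective ξ
    rw [← X.mul_act, act_homElt]
    apply key
    rw [Equiv.symm_apply_apply, Equiv.symm_apply_apply, hs, AutGroup.mul_hom, ← Category.assoc, hs]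
  · rw [Cont.homMk_apply, Equiv.symm_apply_apply]
    refine (key (s χ) 1 ?_).trans (X.one_act x)
    rw [hs, AutGroup.one_hom, Category.comp_id]

variable {t : Cocone (CostructuredArrow.proj ι U ⋙ Ind.yoneda)}

/-- The homomorphism from the automorphisms of `U` to the automorphisms of the ind-object, as a
continuous homomorphism. -/
def continuousAutToInd [Nonempty C] (h : IsHomogeneous ι U) (ht : IsColimit t) :
    AutGroup ι U →ₜ* AutGroup Ind.yoneda t.pt where
  toMonoidHom := autToInd ht
  continuous_toFun := (h.isInducing_autToInd ht).continuous

theorem indArrow_continuousAutToInd [Nonempty C] (h : IsHomogeneous ι U) (ht : IsColimit t)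
    (g : AutGroup ι U) {c : C} (ξ : ι.obj c ⟶ U) :
    indArrow t ξ ≫ (h.continuousAutToInd ht g).hom = indArrow t (ξ ≫ g.hom) :=
  indArrow_autToInd ht g ξ

theorem isInducing [Nonempty C] (h : IsHomogeneous ι U) (ht : IsColimit t) :
    IsInducing (h.continuousAutToInd ht) :=
  h.isInducing_autToInd ht

theorem denseRange [Nonempty C] (h : IsHomogeneous ι U) (ht : IsColimit t) :
    DenseRange (h.continuousAutToInd ht) :=
  h.denseRange_autToInd ht

/-- The abstract extension by density is computed on the sets of arrows: there `k` acts by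
composition, read through the bijection `indArrow`. -/
theorem extendAct_homElt [Nonempty C] (h : IsHomogeneous ι U) (ht : IsColimit t)
    [IsTopologicalGroup (AutGroup Ind.yoneda t.pt)] {k : AutGroup Ind.yoneda t.pt} {c : C}
    {ξ ξ' : ι.obj c ⟶ U} (e : indArrow t ξ' = indArrow t ξ ≫ k.hom) :
    ((homFunctor ι U).obj (op c)).extendAct (h.denseRange ht) (h.isInducing ht) k (homElt c ξ) =
      homElt c ξ' := by
  rw [Cont.extendAct_eq_iff]
  filter_upwards [Filter.preimage_mem_comap
    ((AutGroup.isOpen_setOf_comp_eq (indArrow t ξ) (indArrow t ξ')).mem_nhds e.symm)] with g hg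
  rw [act_homElt, EmbeddingLike.apply_eq_iff_eq]
  exact h.indArrow_injective ht ((h.indArrow_continuousAutToInd ht g ξ).symm.trans hg)

theorem extendAct_homElt_eq_iff [Nonempty C] (h : IsHomogeneous ι U) (ht : IsColimit t)
    [IsTopologicalGroup (AutGroup Ind.yoneda t.pt)] {k k' : AutGroup Ind.yoneda t.pt} {c : C}
    {ξ : ι.obj c ⟶ U} :
    ((homFunctor ι U).obj (op c)).extendAct (h.denseRange ht) (h.isInducing ht) k (homElt c ξ) =
      ((homFunctor ι U).obj (op c)).extendAct (h.denseRange ht) (h.isInducing ht) k'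
        (homElt c ξ) ↔ indArrow t ξ ≫ k.hom = indArrow t ξ ≫ k'.hom := by
  obtain ⟨ξ₁, e₁⟩ := h.exists_indArrow_eq ht (indArrow t ξ ≫ k.hom)
  obtain ⟨ξ₂, e₂⟩ := h.exists_indArrow_eq ht (indArrow t ξ ≫ k'.hom)
  rw [h.extendAct_homElt ht e₁, h.extendAct_homElt ht e₂, ← e₁, ← e₂,
    EmbeddingLike.apply_eq_iff_eq]
  exact ⟨congrArg _, h.indArrow_injective ht⟩

theorem bijective_extendToPointAut [Nonempty C] (h : IsHomogeneous ι U) (ht : IsColimit t)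
    [IsTopologicalGroup (AutGroup Ind.yoneda t.pt)] :
    Function.Bijective (extendToPointAut (h.denseRange ht) (h.isInducing ht)) := by
  constructor
  · intro k k' e
    refine AutGroup.ext (indArrow_hom_ext ht fun c ξ => ?_)
    rw [← h.extendAct_homElt_eq_iff ht, ← extendToPointAut_act, e, extendToPointAut_act]
  · intro α
    -- The restriction of `α` to the sets of arrows is natural in `c`, hence comes from an
    -- automorphism of the ind-object. Agreement on the other actions follows from naturality, since
    -- their elements are images of arrows.
    let φ (c : C) : (ι.obj c ⟶ U) ≃ (ι.obj c ⟶ U) :=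
      ((homElt c).trans (α.equiv _)).trans (homElt c).symm
    have hφ : ∀ (c d : C) (f : c ⟶ d) (ξ : ι.obj d ⟶ U), φ c (ι.map f ≫ ξ) = ι.map f ≫ φ d ξ :=
      fun c d f ξ => α.act_naturality ((homFunctor ι U).map f.op) (homElt d ξ)
    refine ⟨indAut ht φ hφ, PointAut.ext fun X x => ?_⟩
    obtain ⟨c, χ, f, rfl⟩ := h.exists_hom_apply_eq X x
    rw [PointAut.act_naturality, PointAut.act_naturality, extendToPointAut_act,
      h.extendAct_homElt ht (indArrow_indAut ht φ hφ χ).symm]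
    rfl

theorem isCompletion [Nonempty C] (h : IsHomogeneous ι U) (ht : IsColimit t) :
    IsCompletion (h.continuousAutToInd ht).toMonoidHom := by
  have := (h.ind ht).isAlgebraicBase.isTopologicalGroup
  let κ : AutGroup Ind.yoneda t.pt ≃* PointAut (AutGroup ι U) :=
    MulEquiv.ofBijective _ (h.bijective_extendToPointAut ht)
  refine ⟨{ toMulEquiv := κ, continuous_toFun := ?_, continuous_invFun := ?_ },
    extendToPointAut_map (h.denseRange ht) (h.isInducing ht)⟩
  · refine continuous_generateFrom_iff.2 ?_
    rintro _ ⟨_, ⟨X, x, rfl⟩, α, rfl⟩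
    simp_rw [PointAut.inv_mul_mem_stabilizer]
    exact X.isOpen_setOf_extendAct_eq (h.denseRange ht) (h.isInducing ht) x _
  · refine continuous_generateFrom_iff.2 ?_
    rintro _ ⟨_, ⟨c, χ, rfl⟩, k, rfl⟩
    obtain ⟨χ, rfl⟩ := h.exists_indArrow_eq ht χ
    -- The stabilizer of a colimit arrow corresponds to the stabilizer of `χ` as an element of the
    -- continuous action on arrows, so subbasic open sets go to subbasic open sets.
    refine TopologicalSpace.isOpen_generateFrom_of_mem
      ⟨_, ⟨(homFunctor ι U).obj (op c), homElt c χ, rfl⟩, κ k, ?_⟩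
    ext β
    obtain ⟨l, rfl⟩ := κ.surjective β
    change k⁻¹ * κ.symm (κ l) ∈ AutGroup.stabilizer (indArrow t χ) ↔
      (κ k)⁻¹ * κ l ∈ PointAut.stabilizer _ _
    rw [κ.symm_apply_apply, PointAut.inv_mul_mem_stabilizer, AutGroup.inv_mul_mem_stabilizer]
    exact (h.extendAct_homElt_eq_iff ht).symm

/-- The arrows to `U` and to the ind-object correspond, equivariantly. -/
noncomputable def homFunctorResIso [Nonempty C] (h : IsHomogeneous ι U) (ht : IsColimit t) :
    homFunctor ι U ≅ homFunctor Ind.yoneda t.pt ⋙ Cont.res (h.continuousAutToInd ht) :=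
  let f (c : Cᵒᵖ) : (homFunctor ι U).obj c ⟶
      (homFunctor Ind.yoneda t.pt ⋙ Cont.res (h.continuousAutToInd ht)).obj c :=
    Cont.homMk (fun ξ => indArrow t (c := c.unop) ξ)
      fun g ξ => (h.indArrow_continuousAutToInd ht g (c := c.unop) ξ).symm
  have (c : Cᵒᵖ) : IsIso (f c) := Cont.isIso_of_bijective (f c) (h.bijective_indArrow ht c.unop)
  NatIso.ofComponents (fun c => asIso (f c)) fun g =>
    Cont.hom_ext fun ξ => (map_comp_indArrow (t := t) g.unop ξ).symm

end IsHomogeneous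

end Completion

/-! ### Sheaves for the atomic topology -/

section Atomic

variable {C : Type w} [SmallCategory C]

/-- The action of an arrow of `C` on the sections of a presheaf on `Cᵒᵖ`. -/
def push (F : Cᵒᵖᵒᵖ ⥤ Type w) {c d : C} (f : c ⟶ d) (s : F.obj (op (op c))) :
    F.obj (op (op d)) :=
  F.map f.op.op s

theorem push_id (F : Cᵒᵖᵒᵖ ⥤ Type w) {c : C} (s : F.obj (op (op c))) : push F (𝟙 c) s = s :=
  ConcreteCategory.congr_hom (F.map_id (op (op c))) s

theorem push_comp (F : Cᵒᵖᵒᵖ ⥤ Type w) {c d e : C} (f : c ⟶ d) (g : d ⟶ e)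
    (s : F.obj (op (op c))) : push F (f ≫ g) s = push F g (push F f s) :=
  ConcreteCategory.congr_hom (F.map_comp f.op.op g.op.op) s

theorem push_app {F F' : Cᵒᵖᵒᵖ ⥤ Type w} (τ : F ⟶ F') {c d : C} (f : c ⟶ d)
    (s : F.obj (op (op c))) : τ.app _ (push F f s) = push F' f (τ.app _ s) :=
  ConcreteCategory.congr_hom (τ.naturality f.op.op) s

/-- A presheaf on `Cᵒᵖ` is a sheaf for the atomic topology if and only if matching sections over
a single arrow have a unique descent. -/
theorem isSheaf_atomicTopology_iff (hC : AmalgamationProperty C) (F : Cᵒᵖᵒᵖ ⥤ Type w) :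
    Presheaf.IsSheaf (atomicTopology hC) F ↔
      ∀ ⦃c d : C⦄ (f : c ⟶ d) (s : F.obj (op (op d))),
        (∀ (e : C) (p q : d ⟶ e), f ≫ p = f ≫ q → push F p s = push F q s) →
          ∃! s₀ : F.obj (op (op c)), push F f s₀ = s := by
  rw [isSheaf_iff_isSheaf_of_type]
  constructor
  · intro hF c d f s hs
    have h := hF (Sieve.generate (Presieve.singleton f.op))
      ⟨_, f.op, Sieve.le_generate _ _ _ (Presieve.singleton_self f.op)⟩
    rw [← Presieve.isSheafFor_iff_generate, Presieve.isSheafFor_singleton] at h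
    exact h s fun {Z} p q e => hs Z.unop p.unop q.unop (Quiver.Hom.op_inj e)
  · intro hF X S hS x hx
    obtain ⟨Y, f, hf⟩ := hS
    -- A pushed section always satisfies the matching condition, so uniqueness of descent makes
    -- every `push F f` injective.
    have hinj : ∀ ⦃c d : C⦄ (f : c ⟶ d) (s s' : F.obj (op (op c))),
        push F f s = push F f s' → s = s' := fun c d f s s' e =>
      (hF f (push F f s) fun k p q hpq => by rw [← push_comp, ← push_comp, hpq]).unique rfl e.symm
    obtain ⟨s₀, h₀, -⟩ := hF f.unop (x f hf) fun e p q hpq =>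
      hx p.op q.op hf hf (Quiver.Hom.unop_inj hpq)
    refine ⟨s₀, fun Z g hg => ?_, fun s hs => hinj f.unop _ _ ((hs f hf).trans h₀.symm)⟩
    -- The section descended along `f` is compared with the family at any other `g` after
    -- amalgamating `f` and `g`; injectivity of `push F q` then removes `q`.
    obtain ⟨d, p, q, e⟩ := hC f.unop g.unop
    apply hinj q
    calc push F q (push F g.unop s₀) = push F p (push F f.unop s₀) := by
          rw [← push_comp, ← push_comp, e]
      _ = push F p (x f hf) := by rw [h₀]
      _ = push F q (x g hg) := hx p.op q.op hf hg (Quiver.Hom.unop_inj e)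

end Atomic

/-! ### The sheaf of equivariant maps from the sets of arrows -/

section Nerve

variable {C : Type w} [SmallCategory C] {D : Type u} [Category.{w} D] {ι : C ⥤ D} {U : D}

variable (ι U) in
/-- The functor that sends a continuous action `X` to the presheaf of equivariant maps from the
arrows to `U` to `X`. -/
def nerve : Cont (AutGroup ι U) ⥤ Cᵒᵖᵒᵖ ⥤ Type w :=
  yoneda ⋙ (Functor.whiskeringLeft _ _ _).obj (homFunctor ι U).op

/-- The value at an arrow to `U` of a section of the nerve. -/
def nerveEval {X : Cont (AutGroup ι U)} {c : C} (φ : ((nerve ι U).obj X).obj (op (op c)))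
    (χ : ι.obj c ⟶ U) : X.obj.V :=
  InducedCategory.Hom.hom (show (homFunctor ι U).obj (op c) ⟶ X from φ) |>.hom (homElt c χ)

/-- A section of the nerve, from an equivariant map. -/
def nerveMk {X : Cont (AutGroup ι U)} {c : C} (φ : (ι.obj c ⟶ U) → X.obj.V)
    (hφ : ∀ (g : AutGroup ι U) (χ : ι.obj c ⟶ U), φ (χ ≫ g.hom) = X.obj.ρ g (φ χ)) :
    ((nerve ι U).obj X).obj (op (op c)) :=
  (Cont.homMk (fun χ => φ ((homElt c).symm χ)) fun g χ => hφ g ((homElt c).symm χ) :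
    (homFunctor ι U).obj (op c) ⟶ X)

theorem nerveEval_mk {X : Cont (AutGroup ι U)} {c : C} (φ : (ι.obj c ⟶ U) → X.obj.V)
    (hφ : ∀ (g : AutGroup ι U) (χ : ι.obj c ⟶ U), φ (χ ≫ g.hom) = X.obj.ρ g (φ χ))
    (χ : ι.obj c ⟶ U) : nerveEval (nerveMk φ hφ) χ = φ χ := rfl

theorem nerveEval_comp_hom {X : Cont (AutGroup ι U)} {c : C}
    (φ : ((nerve ι U).obj X).obj (op (op c))) (χ : ι.obj c ⟶ U) (g : AutGroup ι U) :
    nerveEval φ (χ ≫ g.hom) = X.obj.ρ g (nerveEval φ χ) :=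
  Cont.hom_act (show (homFunctor ι U).obj (op c) ⟶ X from φ) g (homElt c χ)

theorem nerveEval_push {X : Cont (AutGroup ι U)} {c d : C} (f : c ⟶ d)
    (φ : ((nerve ι U).obj X).obj (op (op c))) (χ : ι.obj d ⟶ U) :
    nerveEval (push _ f φ) χ = nerveEval φ (ι.map f ≫ χ) := rfl

theorem nerveEval_map {X Y : Cont (AutGroup ι U)} (k : X ⟶ Y) {c : C}
    (φ : ((nerve ι U).obj X).obj (op (op c))) (χ : ι.obj c ⟶ U) :
    nerveEval (((nerve ι U).map k).app _ φ) χ = k.hom.hom (nerveEval φ χ) := rfl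

theorem nerve_ext {X : Cont (AutGroup ι U)} {c : C} {φ ψ : ((nerve ι U).obj X).obj (op (op c))}
    (e : ∀ χ, nerveEval φ χ = nerveEval ψ χ) : φ = ψ :=
  Cont.hom_ext (X := (homFunctor ι U).obj (op c)) e

namespace IsHomogeneous

theorem nerve_ext (h : IsHomogeneous ι U) {X : Cont (AutGroup ι U)} {c : C}
    {φ ψ : ((nerve ι U).obj X).obj (op (op c))} {χ : ι.obj c ⟶ U}
    (e : nerveEval φ χ = nerveEval ψ χ) : φ = ψ :=
  GaloisRep.nerve_ext fun χ' => by
    obtain ⟨g, rfl⟩ := h.exists_comp_hom_eq χ χ'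
    rw [nerveEval_comp_hom, nerveEval_comp_hom, e]

theorem exists_nerveEval_eq [Nonempty C] (h : IsHomogeneous ι U) (X : Cont (AutGroup ι U))
    (x : X.obj.V) : ∃ (c : C) (χ : ι.obj c ⟶ U) (φ : ((nerve ι U).obj X).obj (op (op c))),
      nerveEval φ χ = x :=
  h.exists_hom_apply_eq X x

theorem exists_push_eq_push (h : IsHomogeneous ι U) {X : Cont (AutGroup ι U)} {c d : C}
    {χ : ι.obj c ⟶ U} {φ : ((nerve ι U).obj X).obj (op (op c))}
    {χ' : ι.obj d ⟶ U} {φ' : ((nerve ι U).obj X).obj (op (op d))}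
    (e : nerveEval φ χ = nerveEval φ' χ') :
    ∃ (k : C) (p : c ⟶ k) (q : d ⟶ k) (ε : ι.obj k ⟶ U), ι.map p ≫ ε = χ ∧ ι.map q ≫ ε = χ' ∧
      push _ p φ = push _ q φ' := by
  obtain ⟨k, p, q, ε, rfl, rfl⟩ := h.directed c d χ χ'
  exact ⟨k, p, q, ε, rfl, rfl, h.nerve_ext (χ := ε) e⟩

/-- By universality and transitivity, precomposition with `f` is surjective on arrows to `U`. Two
arrows in one fibre factor through a common `ε` by `p` and `q` equalized by `f`, so a matching
section is constant on fibres and descends uniquely. -/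
theorem isSheaf_nerve (h : IsHomogeneous ι U) (X : Cont (AutGroup ι U)) :
    Presheaf.IsSheaf (atomicTopology h.amalgamation) ((nerve ι U).obj X) := by
  rw [isSheaf_atomicTopology_iff]
  intro c d f s hs
  obtain ⟨χ₀⟩ := h.universal d
  have key : ∀ χ χ' : ι.obj d ⟶ U, ι.map f ≫ χ = ι.map f ≫ χ' → nerveEval s χ = nerveEval s χ' := by
    intro χ χ' e
    obtain ⟨k, p, q, ε, rfl, rfl⟩ := h.directed d d χ χ'
    have hpq : f ≫ p = f ≫ q := h.separating _ _ _ _ ε (by simpa using e)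
    exact congrArg (fun φ => nerveEval φ ε) (hs k p q hpq)
  have hsurj : ∀ ξ : ι.obj c ⟶ U, ∃ χ : ι.obj d ⟶ U, ι.map f ≫ χ = ξ := fun ξ => by
    obtain ⟨g, hg⟩ := h.exists_comp_hom_eq (ι.map f ≫ χ₀) ξ
    exact ⟨χ₀ ≫ g.hom, by rw [← hg, Category.assoc]⟩
  choose r hr using hsurj
  refine ⟨nerveMk (fun ξ => nerveEval s (r ξ)) fun g ξ => ?_, ?_, fun s' hs' => ?_⟩
  · rw [← nerveEval_comp_hom]
    apply key
    rw [hr, ← Category.assoc, hr]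
  · refine GaloisRep.nerve_ext fun χ => ?_
    rw [nerveEval_push, nerveEval_mk]
    exact key _ _ (hr _)
  · refine GaloisRep.nerve_ext fun ξ => ?_
    rw [nerveEval_mk, ← hs', nerveEval_push, hr]

/-- The nerve, as a functor to the sheaves for the atomic topology. -/
def nerveSheaf (h : IsHomogeneous ι U) :
    Cont (AutGroup ι U) ⥤ Sheaf (atomicTopology h.amalgamation) (Type w) :=
  ObjectProperty.lift _ (nerve ι U) h.isSheaf_nerve

theorem nerve_faithful [Nonempty C] (h : IsHomogeneous ι U) : (nerve ι U).Faithful where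
  map_injective {X Y k k'} e := Cont.hom_ext fun x => by
    obtain ⟨c, χ, φ, rfl⟩ := h.exists_nerveEval_eq X x
    rw [← nerveEval_map, ← nerveEval_map, e]

theorem nerve_full [Nonempty C] (h : IsHomogeneous ι U) : (nerve ι U).Full where
  map_surjective {X Y} τ := by
    -- Each `x` is a value of some section of the nerve; the preimage of `τ` is read off from the
    -- image of that section, and `key` shows that the choice does not matter.
    choose c χ φ hφ using h.exists_nerveEval_eq X
    have key : ∀ {c d : C} (χ : ι.obj c ⟶ U) (φ : ((nerve ι U).obj X).obj (op (op c)))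
        (χ' : ι.obj d ⟶ U) (φ' : ((nerve ι U).obj X).obj (op (op d))),
        nerveEval φ χ = nerveEval φ' χ' →
          nerveEval (τ.app _ φ) χ = nerveEval (τ.app _ φ') χ' := fun χ φ χ' φ' e => by
      obtain ⟨k, p, q, ε, rfl, rfl, e'⟩ := h.exists_push_eq_push e
      rw [← nerveEval_push, ← nerveEval_push, ← push_app, ← push_app, e']
    refine ⟨Cont.homMk (fun x => nerveEval (τ.app _ (φ x)) (χ x)) fun g x => ?_, ?_⟩
    · rw [← nerveEval_comp_hom]
      apply key
      rw [nerveEval_comp_hom, hφ, hφ]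
    · ext d ψ
      refine GaloisRep.nerve_ext (c := d.unop.unop) fun ξ => ?_
      exact key _ _ _ _ (hφ _)

end IsHomogeneous

end Nerve

/-! ### The action attached to a sheaf -/

section Germs

variable {C : Type w} [SmallCategory C] {D : Type u} [Category.{w} D] {ι : C ⥤ D} {U : D}

/-- Two sections of `F` along arrows to `U` have the same germ. -/
def SameGerm (ι : C ⥤ D) (U : D) (F : Cᵒᵖᵒᵖ ⥤ Type w)
    (x y : Σ c : C, (ι.obj c ⟶ U) × F.obj (op (op c))) : Prop :=
  ∃ (k : C) (p : x.1 ⟶ k) (q : y.1 ⟶ k) (ε : ι.obj k ⟶ U),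
    ι.map p ≫ ε = x.2.1 ∧ ι.map q ≫ ε = y.2.1 ∧ push F p x.2.2 = push F q y.2.2

namespace IsHomogeneous

theorem sameGerm_equivalence (h : IsHomogeneous ι U) (F : Cᵒᵖᵒᵖ ⥤ Type w) :
    Equivalence (SameGerm ι U F) where
  refl x := ⟨x.1, 𝟙 _, 𝟙 _, x.2.1, by simp, by simp, rfl⟩
  symm := fun ⟨k, p, q, ε, hp, hq, e⟩ => ⟨k, q, p, ε, hq, hp, e.symm⟩
  trans {x y z} := by
    rintro ⟨k, p, q, ε, hp, hq, e⟩ ⟨k', p', q', ε', hp', hq', e'⟩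
    obtain ⟨l, r, r', δ, rfl, rfl⟩ := h.directed k k' ε ε'
    -- Both composites become the middle arrow to `U` after `δ`; separation identifies them already
    -- in C.
    have hr : q ≫ r = p' ≫ r' := h.separating _ _ _ _ δ (by simp [hq, hp'])
    refine ⟨l, p ≫ r, q' ≫ r', δ, by simp [hp], by simp [hq'], ?_⟩
    rw [push_comp, e, ← push_comp, hr, push_comp, e', ← push_comp]

/-- The set of germs of `F` at `U`. -/
def Germs (h : IsHomogeneous ι U) (F : Cᵒᵖᵒᵖ ⥤ Type w) : Type w :=
  Quotient ⟨_, h.sameGerm_equivalence F⟩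

/-- The germ of a section along an arrow to `U`. -/
def germ (h : IsHomogeneous ι U) (F : Cᵒᵖᵒᵖ ⥤ Type w) {c : C} (χ : ι.obj c ⟶ U)
    (s : F.obj (op (op c))) : h.Germs F :=
  Quotient.mk _ ⟨c, χ, s⟩

theorem germ_eq_iff (h : IsHomogeneous ι U) (F : Cᵒᵖᵒᵖ ⥤ Type w) {c d : C} {χ : ι.obj c ⟶ U}
    {s : F.obj (op (op c))} {χ' : ι.obj d ⟶ U} {s' : F.obj (op (op d))} :
    h.germ F χ s = h.germ F χ' s' ↔ SameGerm ι U F ⟨c, χ, s⟩ ⟨d, χ', s'⟩ :=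
  Quotient.eq

theorem germ_push (h : IsHomogeneous ι U) (F : Cᵒᵖᵒᵖ ⥤ Type w) {c d : C} (f : c ⟶ d)
    (χ : ι.obj d ⟶ U) (s : F.obj (op (op c))) :
    h.germ F χ (push F f s) = h.germ F (ι.map f ≫ χ) s :=
  (h.germ_eq_iff F).2 ⟨d, 𝟙 d, f, χ, by simp, rfl, push_id F _⟩

theorem exists_germ_eq (h : IsHomogeneous ι U) (F : Cᵒᵖᵒᵖ ⥤ Type w) (x : h.Germs F) :
    ∃ (c : C) (χ : ι.obj c ⟶ U) (s : F.obj (op (op c))), h.germ F χ s = x := by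
  obtain ⟨⟨c, χ, s⟩, rfl⟩ := Quotient.exists_rep x
  exact ⟨c, χ, s, rfl⟩

/-- The action of the automorphisms of `U` on the germs of `F`. -/
def actGerm (h : IsHomogeneous ι U) (F : Cᵒᵖᵒᵖ ⥤ Type w) (g : AutGroup ι U) :
    h.Germs F → h.Germs F :=
  Quotient.lift (fun x => h.germ F (x.2.1 ≫ g.hom) x.2.2) <| by
    rintro ⟨c, χ, s⟩ ⟨d, χ', s'⟩ ⟨k, p, q, ε, hp, hq, e⟩
    refine (h.germ_eq_iff F).2 ⟨k, p, q, ε ≫ g.hom, ?_, ?_, e⟩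
    · rw [← Category.assoc, hp]
    · rw [← Category.assoc, hq]

theorem actGerm_germ (h : IsHomogeneous ι U) (F : Cᵒᵖᵒᵖ ⥤ Type w) (g : AutGroup ι U) {c : C}
    (χ : ι.obj c ⟶ U) (s : F.obj (op (op c))) :
    h.actGerm F g (h.germ F χ s) = h.germ F (χ ≫ g.hom) s := rfl

/-- The continuous action on the germs of `F`. -/
def germAction [Nonempty C] (h : IsHomogeneous ι U) (F : Cᵒᵖᵒᵖ ⥤ Type w) :
    Cont (AutGroup ι U) :=
  Cont.of (h.Germs F) (h.actGerm F)
    (fun x => by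
      obtain ⟨c, χ, s, rfl⟩ := h.exists_germ_eq F x
      rw [actGerm_germ, AutGroup.one_hom, Category.comp_id])
    (fun g k x => by
      obtain ⟨c, χ, s, rfl⟩ := h.exists_germ_eq F x
      rw [actGerm_germ, actGerm_germ, actGerm_germ, AutGroup.mul_hom, Category.assoc])
    (fun x y => by
      rw [isOpen_iff_mem_nhds]
      intro g hg
      obtain ⟨c, χ, s, rfl⟩ := h.exists_germ_eq F x
      refine (h.mem_nhds_iff _ _).2 ⟨c, χ, fun k hk => ?_⟩
      rw [Set.mem_ofPred_eq, actGerm_germ] at hg ⊢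
      rw [← hg]
      exact congrArg (fun χ => h.germ F χ s) hk)

/-- The canonical map from a presheaf to the nerve of its action on germs. -/
def toNerve [Nonempty C] (h : IsHomogeneous ι U) (F : Cᵒᵖᵒᵖ ⥤ Type w) :
    F ⟶ (nerve ι U).obj (h.germAction F) where
  app c := ↾fun s => nerveMk (c := c.unop.unop) (fun χ => h.germ F χ s) fun _ _ => rfl
  naturality c d f := by
    ext s
    exact GaloisRep.nerve_ext (c := d.unop.unop) fun χ => h.germ_push F f.unop.unop χ s

theorem nerveEval_toNerve [Nonempty C] (h : IsHomogeneous ι U) (F : Cᵒᵖᵒᵖ ⥤ Type w) {c : C}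
    (s : F.obj (op (op c))) (χ : ι.obj c ⟶ U) :
    nerveEval ((h.toNerve F).app _ s) χ = h.germ F χ s := rfl

theorem push_injective (h : IsHomogeneous ι U) {F : Cᵒᵖᵒᵖ ⥤ Type w}
    (hF : Presheaf.IsSheaf (atomicTopology h.amalgamation) F) {c d : C} (f : c ⟶ d) :
    Function.Injective (push F f) := fun s s' e =>
  ((isSheaf_atomicTopology_iff _ _).1 hF f (push F f s) fun k p q hpq => by
    rw [← push_comp, ← push_comp, hpq]).unique rfl e.symm

/-- Over a single `χ`, the two arrows witnessing equality of germs have the same composite to `U`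
and so coincide; for a sheaf, pushing along one arrow is injective. -/
theorem germ_injective (h : IsHomogeneous ι U) {F : Cᵒᵖᵒᵖ ⥤ Type w}
    (hF : Presheaf.IsSheaf (atomicTopology h.amalgamation) F) {c : C} (χ : ι.obj c ⟶ U) :
    Function.Injective (h.germ F χ) := fun s s' e => by
  obtain ⟨k, p, q, ε, hp, hq, e⟩ := (h.germ_eq_iff F).1 e
  obtain rfl : p = q := h.separating _ _ _ _ ε (hp.trans hq.symm)
  exact h.push_injective hF p e

theorem bijective_toNerve [Nonempty C] (h : IsHomogeneous ι U) {F : Cᵒᵖᵒᵖ ⥤ Type w}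
    (hF : Presheaf.IsSheaf (atomicTopology h.amalgamation) F) (c : C) :
    Function.Bijective fun s : F.obj (op (op c)) => (h.toNerve F).app _ s := by
  obtain ⟨ξ⟩ := h.universal c
  constructor
  · intro s s' e
    exact h.germ_injective hF ξ (congrArg (fun φ => nerveEval φ ξ) e)
  · intro φ
    obtain ⟨d, χ, s, hs⟩ := h.exists_germ_eq F (nerveEval φ ξ)
    obtain ⟨k, f, p, ε, rfl, rfl⟩ := h.directed c d ξ χ
    rw [← germ_push] at hs
    -- The section with the prescribed germ lives over `k` and must descend along `f`. Automorphisms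
    -- `σ`, `τ` carry `ε` to the composites of `q` and `q'` with `δ`; they agree on the restriction
    -- of `ε` along `f`, so equivariance of `φ` gives both pushes the same germ at `δ`.
    obtain ⟨s₀, hs₀, -⟩ := (isSheaf_atomicTopology_iff _ _).1 hF f (push F p s) fun l q q' hq => by
      obtain ⟨δ⟩ := h.universal l
      obtain ⟨σ, hσ⟩ := h.exists_comp_hom_eq ε (ι.map q ≫ δ)
      obtain ⟨τ, hτ⟩ := h.exists_comp_hom_eq ε (ι.map q' ≫ δ)
      have e : (ι.map f ≫ ε) ≫ σ.hom = (ι.map f ≫ ε) ≫ τ.hom := by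
        rw [Category.assoc, Category.assoc, hσ, hτ, ← ι.map_comp_assoc, ← ι.map_comp_assoc, hq]
      apply h.germ_injective hF δ
      rw [h.germ_push F q δ, h.germ_push F q' δ, ← hσ, ← hτ]
      have hφ : ∀ ρ : AutGroup ι U,
          nerveEval φ ((ι.map f ≫ ε) ≫ ρ.hom) = h.germ F (ε ≫ ρ.hom) (push F p s) := fun ρ => by
        rw [nerveEval_comp_hom, ← hs]
        rfl
      exact (hφ σ).symm.trans ((congrArg (nerveEval φ) e).trans (hφ τ))
    refine ⟨s₀, h.nerve_ext (χ := ι.map f ≫ ε) ?_⟩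
    rw [nerveEval_toNerve, ← germ_push, hs₀, hs]

theorem nerveSheaf_isEquivalence [Nonempty C] (h : IsHomogeneous ι U) :
    h.nerveSheaf.IsEquivalence where
  faithful := by
    have := h.nerve_faithful
    exact inferInstanceAs (ObjectProperty.lift _ (nerve ι U) h.isSheaf_nerve).Faithful
  full := by
    have := h.nerve_full
    exact inferInstanceAs (ObjectProperty.lift _ (nerve ι U) h.isSheaf_nerve).Full
  essSurj := ⟨fun F => by
    have : ∀ c, IsIso ((h.toNerve F.obj).app c) := fun c =>
      (isIso_iff_bijective _).2 (h.bijective_toNerve F.property c.unop.unop)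
    have : IsIso (h.toNerve F.obj) := NatIso.isIso_of_isIso_app _
    exact ⟨h.germAction F.obj,
      ⟨(fullyFaithfulSheafToPresheaf _ _).preimageIso (asIso (h.toNerve F.obj)).symm⟩⟩⟩

end IsHomogeneous

end Germs

/-! ### Representable presheaves -/

section Representable

variable {C : Type w} [SmallCategory C] {D : Type u} [Category.{w} D] {ι : C ⥤ D} {U : D}

variable (ι U) in
/-- The canonical map from a representable presheaf to the nerve of the set of arrows to `U`. -/
def yonedaToNerve : (yoneda : Cᵒᵖ ⥤ Cᵒᵖᵒᵖ ⥤ Type w) ⟶ homFunctor ι U ⋙ nerve ι U where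
  app c := yonedaMap (homFunctor ι U) c
  naturality c d f := by
    ext e k
    exact (homFunctor ι U).map_comp k f

theorem nerveEval_yonedaToNerve {c d : C} (f : c ⟶ d) (χ : ι.obj d ⟶ U) :
    nerveEval (((yonedaToNerve ι U).app (op c)).app (op (op d)) f.op) χ =
      homElt c (ι.map f ≫ χ) := rfl

namespace IsHomogeneous

theorem w_yonedaToNerve (h : IsHomogeneous ι U) (c : Cᵒᵖ) :
    (atomicTopology h.amalgamation).W ((yonedaToNerve ι U).app c) := by
  rw [GrothendieckTopology.W_iff_isLocallyBijective]
  constructor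
  · refine Presheaf.isLocallyInjective_of_injective _ _ fun d f f' e => ?_
    obtain ⟨χ⟩ := h.universal d.unop.unop
    exact Quiver.Hom.unop_inj (h.separating _ _ _ _ χ
      (congrArg (fun φ => nerveEval (c := d.unop.unop) φ χ) e))
  · refine ⟨fun {d} s => ?_⟩
    obtain ⟨χ⟩ := h.universal d.unop
    -- The equivariant map `s` sends `χ` to an arrow from `c` to `U`. Once both factor through `ε`,
    -- the push of `s` along `p` agrees at `ε` with precomposition by `q`, hence everywhere by
    -- transitivity.
    obtain ⟨k, p, q, ε, hp, hq⟩ := h.directed d.unop c.unop χ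
      ((homElt c.unop).symm (nerveEval (c := d.unop) s χ))
    refine ⟨op k, p.op, q.op, h.nerve_ext (c := k) (χ := ε) ?_⟩
    refine (nerveEval_yonedaToNerve q ε).trans ?_
    rw [hq, Equiv.apply_symm_apply, ← hp]
    rfl

/-- The nerve of the set of arrows to `U` is the sheaf associated with a representable presheaf. -/
noncomputable def sheafifiedYonedaIso (h : IsHomogeneous ι U) :
    sheafifiedYoneda h.amalgamation ≅ homFunctor ι U ⋙ h.nerveSheaf :=
  let J := atomicTopology h.amalgamation
  let α := Functor.whiskerRight (yonedaToNerve ι U) (presheafToSheaf J (Type w))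
  have : ∀ c : Cᵒᵖ, IsIso (α.app c) := fun c =>
    (GrothendieckTopology.W_iff J _).1 (h.w_yonedaToNerve c)
  have : IsIso α := NatIso.isIso_of_isIso_app α
  @asIso _ _ _ _ α this ≪≫
    Functor.isoWhiskerLeft (homFunctor ι U ⋙ h.nerveSheaf)
      (asIso (sheafificationAdjunction J (Type w)).counit) ≪≫ Functor.rightUnitor _

end IsHomogeneous

end Representable

end GaloisRep

open GaloisRep
theorem theorem4p7
    {C : Type w} [SmallCategory C] [Nonempty C] {D : Type u} [Category.{w} D]
    (ι : C ⥤ D) [ι.Full] [ι.Faithful] (U : D)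
    (hU : IsUniversal ι U) (hU' : IsUltrahomogeneous ι U)
    (ha : ∀ (a b : C) (ξ : ι.obj a ⟶ U) (χ : ι.obj b ⟶ U),
      ∃ (c : C) (f : a ⟶ c) (g : b ⟶ c) (ε : ι.obj c ⟶ U), ι.map f ≫ ε = ξ ∧ ι.map g ≫ ε = χ)
    (hb : ∀ (a b : C) (f g : a ⟶ b) (χ : ι.obj b ⟶ U), ι.map f ≫ χ = ι.map g ≫ χ → f = g) :
    ∃ hAP : AmalgamationProperty C,
      JointEmbeddingProperty C ∧
      IsAlgebraicBase (stabilizers ι U) ∧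
      IsFiltered (CostructuredArrow ι U) ∧
      HasColimit (CostructuredArrow.proj ι U ⋙ Ind.yoneda) ∧
      ∀ (t : Cocone (CostructuredArrow.proj ι U ⋙ Ind.yoneda)), IsColimit t →
        IsUniversal Ind.yoneda t.pt ∧
        IsUltrahomogeneous Ind.yoneda t.pt ∧
        IsAlgebraicBase (stabilizers Ind.yoneda t.pt) ∧
        ∃ θ : AutGroup ι U →ₜ* AutGroup Ind.yoneda t.pt,
          (∀ (g : AutGroup ι U) (c : C) (ξ : ι.obj c ⟶ U),
            t.ι.app (CostructuredArrow.mk ξ) ≫ (θ g).hom =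
              t.ι.app (CostructuredArrow.mk (ξ ≫ g.hom))) ∧
          IsCompletion θ.toMonoidHom ∧
          ∃ (E : Sheaf (atomicTopology hAP) (Type w) ≌ Cont (AutGroup ι U))
            (K : Cont (AutGroup ι U) ≌ Cont (AutGroup Ind.yoneda t.pt)),
            Nonempty (sheafifiedYoneda hAP ⋙ E.functor ≅ homFunctor ι U) ∧
            Nonempty (sheafifiedYoneda hAP ⋙ E.functor ⋙ K.functor ≅
              homFunctor Ind.yoneda t.pt) ∧
            Nonempty (K.inverse ≅ Cont.res θ) := by
  have h : IsHomogeneous ι U := ⟨hU, hU', ha, hb⟩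
  have := h.isFiltered
  refine ⟨h.amalgamation, h.jointEmbedding, h.isAlgebraicBase, this, inferInstance,
    fun t ht => ?_⟩
  have hI := h.ind ht
  have := hI.isAlgebraicBase.isTopologicalGroup
  have := h.nerveSheaf_isEquivalence
  have := Cont.res_isEquivalence (h.denseRange ht) (h.isInducing ht)
  let R := h.nerveSheaf.asEquivalence
  let S := (Cont.res (h.continuousAutToInd ht)).asEquivalence
  let e : sheafifiedYoneda h.amalgamation ⋙ R.inverse ≅ homFunctor ι U :=
    Functor.isoWhiskerRight h.sheafifiedYonedaIso R.inverse ≪≫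
      Functor.isoWhiskerLeft (homFunctor ι U) R.unitIso.symm ≪≫ Functor.rightUnitor _
  let e' : homFunctor ι U ⋙ S.inverse ≅ homFunctor Ind.yoneda t.pt :=
    Functor.isoWhiskerRight (h.homFunctorResIso ht) S.inverse ≪≫
      Functor.isoWhiskerLeft (homFunctor Ind.yoneda t.pt) S.unitIso.symm ≪≫ Functor.rightUnitor _
  -- Both equivalences are reversed: the nerve and the restriction are their inverse functors, so
  -- the last isomorphism is the identity.
  exact ⟨hI.universal, hI.ultrahomogeneous, hI.isAlgebraicBase, h.continuousAutToInd ht,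
    fun g c ξ => h.indArrow_continuousAutToInd ht g ξ, h.isCompletion ht, R.symm, S.symm, ⟨e⟩,
    ⟨Functor.isoWhiskerRight e S.inverse ≪≫ e'⟩, ⟨Iso.refl _⟩⟩
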